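/- Let $B_N=\{z\in\mathbb C^N:|z|<1\}$ and let $\varphi:B_N\to B_N$ be a linear fractional self-map, i.e. $\varphi(z)=\dfrac{Ez+f}{\langle z,g\rangle+h}$ with $E\in\mathbb C^{N\times N}$, $f,g\in\mathbb C^N$, $h\in\mathbb C$ and $\langle z,g\rangle+h\neq0$ on $B_N$ (inner products are linear in the first variable). Suppose that $\varphi$ is hyperbolic: it has no fixed point in $B_N$, and its boundary dilation coefficient $$\delta=\liminf_{z\to w}\frac{1-|\varphi(z)|^2}{1-|z|^2}$$ lies in $(0,1)$, where $w\in\partial B_N$ is the Denjoy–Wolff point of $\varphi$ (the point to which the iterates of $\varphi$ converge uniformly on compact subsets of $B_N$). Put $\lambda=1/\delta>1$. Then there are integers $p,q,r\ge0$ with $1+p+q+r=N$ (so some of the variables $u,v,w$ below may be absent), a number $b\in\mathbb C$, a vector $c\in\mathbb C^r$ and matrices $D\in\mathbb C^{q\times q}$, $A\in\mathbb C^{r\times r}$ such that $\varphi$ is conjugate to the self-map $$\psi(z,u,v,w)=(\lambda z+b,\ \sqrt\lambda\,u,\ \sqrt\lambda\,Dv,\ \sqrt\lambda\,Aw+c)$$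 of the Siegel half-plane $\mathbb H^N=\{(z,u,v,w)\in\mathbb C\times\mathbb C^p\times\mathbb C^q\times\mathbb C^r:\operatorname{Im}z>|u|^2+|v|^2+|w|^2\}$; that is, $\psi$ maps $\mathbb H^N$ into itself and $\psi=\sigma\circ\varphi\circ\sigma^{-1}$ for some biholomorphic map $\sigma:B_N\to\mathbb H^N$. Moreover: 1. $D$ is diagonal and its spectrum is contained in $\{\mu\in\mathbb C:|\mu|=1\}\setminus\{1\}$, while every eigenvalue of $A$ has modulus less than $1$; 2. both $Q=I-A^HA$ and $P=I-AA^H$ are Hermitian positive semidefinite; 3. $\operatorname{Im}b\ge\langle P^+c,c\rangle$, where $P^+$ is the (Moore–Penrose) pseudo-inverse of $P$; 4. $QQ^+A^Hc=A^Hc$, where $Q^+$ is the pseudo-inverse of $Q$. -/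

import Mathlib

open Filter Topology Set
open scoped Matrix ComplexOrder

/-- Complex Euclidean space `ℂ^n`. -/
abbrev CSpace (n : ℕ) : Type := EuclideanSpace ℂ (Fin n)

/-- The open unit ball `B_N` of `ℂ^N`. -/
def unitBall (N : ℕ) : Set (CSpace N) := Metric.ball 0 1

/-- The action of a square complex matrix on `ℂ^n`. -/
noncomputable def matVec {n : ℕ} (A : Matrix (Fin n) (Fin n) ℂ) (z : CSpace n) : CSpace n :=
  WithLp.toLp 2 (A *ᵥ z.ofLp)

/-- `φ ∈ LFT(B_N)`: a self-map of the ball of the form `z ↦ (A z + B) / (⟨z, C⟩ + D)`, the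
denominator having no zero in the ball. Here `⟨z, C⟩` is linear in `z`, which in Mathlib's
convention is `inner ℂ C z`. Only the values of `φ` on the ball matter. -/
def IsLFTBall {N : ℕ} (φ : CSpace N → CSpace N) : Prop :=
  MapsTo φ (unitBall N) (unitBall N) ∧
  ∃ (A : Matrix (Fin N) (Fin N) ℂ) (B C : CSpace N) (D : ℂ),
    ∀ z ∈ unitBall N, inner ℂ C z + D ≠ 0 ∧
      φ z = (inner ℂ C z + D)⁻¹ • (matVec A z + B)

/-- `w` is the Denjoy-Wolff point of `φ`: a point of the unit sphere to which the iterates of `φ`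
converge uniformly on compact subsets of the ball. -/
def IsDenjoyWolffPoint {N : ℕ} (φ : CSpace N → CSpace N) (w : CSpace N) : Prop :=
  ‖w‖ = 1 ∧ ∀ K ⊆ unitBall N, IsCompact K →
    TendstoUniformlyOn (fun n : ℕ => φ^[n]) (fun _ => w) atTop K

/-- `δ` is the boundary dilation coefficient of `φ`, that is,
`δ = liminf_{z → w} (1 - |φ(z)|²) / (1 - |z|²)` with `w` the Denjoy-Wolff point of `φ`
(the lower limit is taken over `z` in the ball, in the extended reals). -/
def HasBoundaryDilation {N : ℕ} (φ : CSpace N → CSpace N) (δ : ℝ) : Prop :=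
  ∃ w : CSpace N, IsDenjoyWolffPoint φ w ∧
    liminf (fun z : CSpace N => (((1 - ‖φ z‖ ^ 2) / (1 - ‖z‖ ^ 2) : ℝ) : EReal))
      (𝓝[unitBall N] w) = (δ : EReal)

/-- A self-map of the ball is hyperbolic if it has no fixed point in the ball and its boundary
dilation coefficient lies in `(0, 1)`. -/
def IsHyperbolicMap {N : ℕ} (φ : CSpace N → CSpace N) : Prop :=
  (∀ z ∈ unitBall N, φ z ≠ z) ∧ ∃ δ ∈ Ioo (0 : ℝ) 1, HasBoundaryDilation φ δ

/-- The Siegel half-plane `ℍ^N = {(z, W) ∈ ℂ × ℂ^(N-1) : Im z > |W|²}`, where `ℂ^(N-1)` is written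
as `ℂ^p × ℂ^q × ℂ^r` with `1 + p + q + r = N` and `W = (u, v, w)`. -/
def siegel (p q r : ℕ) : Set (ℂ × CSpace p × CSpace q × CSpace r) :=
  {x | ‖x.2.1‖ ^ 2 + ‖x.2.2.1‖ ^ 2 + ‖x.2.2.2‖ ^ 2 < x.1.im}

/-- The self-map `φ` of `U` and the self-map `ψ` of `V` are conjugate: `ψ = σ ∘ φ ∘ σ⁻¹` on `V` for
a biholomorphic map `σ` of `U` onto `V`, with inverse `τ`. -/
def AreConjugate {E F : Type*} [NormedAddCommGroup E] [NormedSpace ℂ E]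
    [NormedAddCommGroup F] [NormedSpace ℂ F]
    (φ : E → E) (U : Set E) (ψ : F → F) (V : Set F) : Prop :=
  ∃ (σ : E → F) (τ : F → E),
    DifferentiableOn ℂ σ U ∧ DifferentiableOn ℂ τ V ∧
    MapsTo σ U V ∧ MapsTo τ V U ∧ LeftInvOn τ σ U ∧ RightInvOn τ σ V ∧
    ∀ x ∈ V, ψ x = σ (φ (τ x))

/-- The map `(z, u, v, w) ↦ (ℓ z + b, √ℓ u, √ℓ D v, √ℓ A w + c)`. -/
noncomputable def hyperbolicForm {p q r : ℕ} (ℓ : ℝ) (b : ℂ) (D : Matrix (Fin q) (Fin q) ℂ)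
    (A : Matrix (Fin r) (Fin r) ℂ) (c : CSpace r) :
    ℂ × CSpace p × CSpace q × CSpace r → ℂ × CSpace p × CSpace q × CSpace r :=
  fun x => ((ℓ : ℂ) * x.1 + b, (√ℓ : ℂ) • x.2.1, (√ℓ : ℂ) • matVec D x.2.2.1,
    (√ℓ : ℂ) • matVec A x.2.2.2 + c)

/-- The four Penrose equations: `X` is the Moore-Penrose pseudo-inverse of `M`. -/
structure IsPseudoInverse {n : ℕ} (M X : Matrix (Fin n) (Fin n) ℂ) : Prop where
  mul_mul_left : M * X * M = M
  mul_mul_right : X * M * X = X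
  herm_left : (M * X).IsHermitian
  herm_right : (X * M).IsHermitian

theorem IsPseudoInverse.unique {n : ℕ} {M X Y : Matrix (Fin n) (Fin n) ℂ}
    (hX : IsPseudoInverse M X) (hY : IsPseudoInverse M Y) : X = Y := by
  have h1 : M * X = M * Y := by
    have e : (M * Y * (M * X))ᴴ = M * X * (M * Y) := by
      rw [Matrix.conjTranspose_mul, hX.herm_left.eq, hY.herm_left.eq]
    have e1 : M * Y * (M * X) = M * X := by rw [← mul_assoc, hY.mul_mul_left]
    have e2 : M * X * (M * Y) = M * Y := by rw [← mul_assoc, hX.mul_mul_left]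
    rw [e1, e2, hX.herm_left.eq] at e
    exact e
  have h2 : X * M = Y * M := by
    have e : (X * M * (Y * M))ᴴ = Y * M * (X * M) := by
      rw [Matrix.conjTranspose_mul, hX.herm_right.eq, hY.herm_right.eq]
    have e1 : X * M * (Y * M) = X * M := by rw [mul_assoc, ← mul_assoc M, hY.mul_mul_left]
    have e2 : Y * M * (X * M) = Y * M := by rw [mul_assoc, ← mul_assoc M, hX.mul_mul_left]
    rw [e1, e2, hX.herm_right.eq] at e
    exact e
  calc X = X * M * X := hX.mul_mul_right.symm
    _ = Y * (M * X) := by rw [h2, mul_assoc]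
    _ = Y := by rw [h1, ← mul_assoc, hY.mul_mul_right]

theorem exists_isPseudoInverse_of_isHermitian {n : ℕ} {H : Matrix (Fin n) (Fin n) ℂ}
    (hH : H.IsHermitian) :
    ∃ G, IsPseudoInverse H G ∧ G.IsHermitian ∧ H * G = G * H := by
  set U : Matrix (Fin n) (Fin n) ℂ := (hH.eigenvectorUnitary : Matrix (Fin n) (Fin n) ℂ) with hU
  have hUU : Uᴴ * U = 1 := Matrix.mem_unitaryGroup_iff'.mp hH.eigenvectorUnitary.2
  set d : Fin n → ℂ := fun i => (hH.eigenvalues i : ℂ) with hd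
  have hHd : H = U * Matrix.diagonal d * Uᴴ := by
    have h := hH.spectral_theorem
    rw [Unitary.conjStarAlgAut_apply] at h
    exact h
  have key : ∀ a b : Fin n → ℂ, (U * Matrix.diagonal a * Uᴴ) * (U * Matrix.diagonal b * Uᴴ)
      = U * Matrix.diagonal (fun i => a i * b i) * Uᴴ := by
    intro a b
    calc _ = U * Matrix.diagonal a * (Uᴴ * U) * Matrix.diagonal b * Uᴴ := by
          simp only [mul_assoc]
      _ = _ := by rw [hUU, mul_one, mul_assoc U, Matrix.diagonal_mul_diagonal]
  have herm : ∀ a : Fin n → ℝ, (U * Matrix.diagonal (fun i => (a i : ℂ)) * Uᴴ).IsHermitian := by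
    intro a
    rw [Matrix.IsHermitian, Matrix.conjTranspose_mul, Matrix.conjTranspose_mul,
      Matrix.conjTranspose_conjTranspose, Matrix.diagonal_conjTranspose, mul_assoc]
    congr 3
    ext i
    simp
  have c1 : (fun i => d i * (d i)⁻¹ : Fin n → ℂ)
      = fun i => ((hH.eigenvalues i * (hH.eigenvalues i)⁻¹ : ℝ) : ℂ) := by
    ext i; simp [hd]
  have c2 : (fun i => (d i)⁻¹ * d i : Fin n → ℂ)
      = fun i => ((hH.eigenvalues i * (hH.eigenvalues i)⁻¹ : ℝ) : ℂ) := by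
    ext i; simp [hd, mul_comm]
  have c3 : (fun i => (d i)⁻¹ : Fin n → ℂ)
      = fun i => (((hH.eigenvalues i)⁻¹ : ℝ) : ℂ) := by
    ext i; simp [hd]
  refine ⟨U * Matrix.diagonal (fun i => (d i)⁻¹) * Uᴴ, ⟨?_, ?_, ?_, ?_⟩, ?_, ?_⟩
  · rw [hHd, key, key]; simp
  · rw [hHd, key, key]
    have e : (fun i => (d i)⁻¹ * d i * (d i)⁻¹) = fun i => (d i)⁻¹ := by
      ext i
      by_cases h : d i = 0
      · simp [h]
      · field_simp
    rw [e]
  · rw [hHd, key, c1]; exact herm _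
  · rw [hHd, key, c2]; exact herm _
  · rw [c3]; exact herm _
  · rw [hHd, key, key, c1, c2]

theorem exists_isPseudoInverse {n : ℕ} (M : Matrix (Fin n) (Fin n) ℂ) :
    ∃ X, IsPseudoInverse M X := by
  obtain ⟨G, hG, hGh, hc⟩ :=
    exists_isPseudoInverse_of_isHermitian (Matrix.isHermitian_conjTranspose_mul_self M)
  have hHh : (Mᴴ * M)ᴴ = Mᴴ * M := (Matrix.isHermitian_conjTranspose_mul_self M).eq
  have h0 : M * (G * (Mᴴ * M)) - M = 0 := by
    rw [← Matrix.conjTranspose_mul_self_eq_zero, Matrix.conjTranspose_sub,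
      Matrix.conjTranspose_mul, Matrix.conjTranspose_mul, hHh, hGh.eq]
    have e : Mᴴ * M * (G * (Mᴴ * M)) = Mᴴ * M := by rw [← mul_assoc, hG.mul_mul_left]
    have e1 : Mᴴ * (M * (G * (Mᴴ * M)) - M) = 0 := by
      rw [mul_sub, ← mul_assoc Mᴴ M, e, sub_self]
    rw [sub_mul, mul_assoc (Mᴴ * M * G), e1, mul_zero, sub_zero]
  refine ⟨G * Mᴴ, ?_, ?_, ?_, ?_⟩
  · rw [sub_eq_zero] at h0
    simpa only [mul_assoc] using h0
  · have e := congrArg (· * Mᴴ) hG.mul_mul_right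
    simpa only [mul_assoc] using e
  · rw [Matrix.IsHermitian, Matrix.conjTranspose_mul, Matrix.conjTranspose_mul,
      Matrix.conjTranspose_conjTranspose, hGh.eq, mul_assoc]
  · rw [mul_assoc]; exact hG.herm_right

/-- The Moore-Penrose pseudo-inverse of a square complex matrix. -/
noncomputable def pseudoInv {n : ℕ} (M : Matrix (Fin n) (Fin n) ℂ) : Matrix (Fin n) (Fin n) ℂ :=
  (exists_isPseudoInverse M).choose

theorem isPseudoInverse_pseudoInv {n : ℕ} (M : Matrix (Fin n) (Fin n) ℂ) :
    IsPseudoInverse M (pseudoInv M) :=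
  (exists_isPseudoInverse M).choose_spec

/-!
If the denominator of `φ` vanished at the Denjoy–Wolff point `w`, boundedness would force `φ` to be
constant on the ball, hence to have a fixed point there; so `φ` is continuous at `w` and `φ(w) = w`.
The Cayley transform sending `w` to infinity then turns `φ` into an affine self-map
`(ζ, ω) ↦ (ℓ ζ + a ω + b, M ω + c)` of the Siegel half-plane. There the quotient in the dilation
coefficient is governed by the height `Im ζ - ‖ω‖²`, which such a map multiplies by at least `ℓ`,
and asymptotically by exactly `ℓ` along `(i y, 0)`; the Cayley transform contributes a factor
tending to `ℓ⁻²`, so `δ = 1 / ℓ`.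

Scaling `ω` shows `‖M‖ ≤ √ℓ < ℓ`, so `ℓ - M^*` is onto and a Heisenberg translation removes `a`.
The self-map condition, on the boundary, now reads `‖T ω + c‖² ≤ ‖ω‖² + Im b` with the contraction
`T = M / √ℓ`. Eigenvectors of a contraction with unimodular eigenvalues split off orthogonally, and
the inequality forces `c` to be orthogonal to them; what remains of `T` is the block `A`. Finally
the inequality gives `⟨A x, c⟩ = 0` whenever `‖A x‖ = ‖x‖`, so `Aᴴ c` lies in the range of
`Q = 1 - Aᴴ A`, and taken at the maximizer `x = Q⁺ Aᴴ c` of `‖A x + c‖² - ‖x‖²` it becomes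
`⟨P⁺ c, c⟩ ≤ Im b`.
-/

section Limits

theorem eq_zero_of_forall_mul_add_nonneg {x y : ℝ} (h : ∀ t, 0 ≤ x * t + y) : x = 0 := by
  by_contra hx
  have := h (-(y + 1) / x)
  rw [mul_div_cancel₀ _ hx] at this
  linarith

theorem eq_zero_of_forall_norm_smul_add_le {X : Type*} [NormedAddCommGroup X] [NormedSpace ℝ X]
    {u v : X} {K : ℝ} (h : ∀ t : ℝ, 0 < t → ‖t • u + v‖ ≤ K) : u = 0 := by
  by_contra hu
  have ht : 0 < (K + ‖v‖ + 1) / ‖u‖ := by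
    have hK := (norm_nonneg _).trans (h 1 one_pos)
    positivity
  have hsum : K + ‖v‖ + 1 ≤ K + ‖v‖ :=
    calc K + ‖v‖ + 1 = ‖((K + ‖v‖ + 1) / ‖u‖) • u‖ := by
          rw [norm_smul, Real.norm_of_nonneg ht.le, div_mul_cancel₀ _ (norm_ne_zero_iff.2 hu)]
      _ ≤ ‖((K + ‖v‖ + 1) / ‖u‖) • u + v‖ + ‖v‖ := norm_le_add_norm_add _ _
      _ ≤ K + ‖v‖ := by gcongr; exact h _ ht
  linarith

theorem liminf_eq_of_le_of_tendsto_comp {α β γ : Type*} [CompleteLinearOrder γ]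
    [TopologicalSpace γ] [OrderTopology γ] {l : Filter α} {m : Filter β} [m.NeBot]
    {u v : α → γ} {p : β → α} {a : γ} (hv : Tendsto v l (𝓝 a)) (hvu : v ≤ᶠ[l] u)
    (hp : Tendsto p m l) (hu : Tendsto (u ∘ p) m (𝓝 a)) : liminf u l = a := by
  have : l.NeBot := hp.neBot
  refine le_antisymm ?_ (hv.liminf_eq.symm.trans_le (liminf_le_liminf hvu))
  calc liminf u l ≤ liminf u (map p m) := liminf_le_liminf_of_le hp
    _ = a := hu.liminf_eq

end Limits

section Conjugacy

variable {E F G : Type*} [NormedAddCommGroup E] [NormedSpace ℂ E] [NormedAddCommGroup F]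
  [NormedSpace ℂ F] [NormedAddCommGroup G] [NormedSpace ℂ G]
  {φ : E → E} {ψ : F → F} {χ : G → G} {U : Set E} {V : Set F} {W : Set G}

theorem AreConjugate.of_semiconj {σ : E → F} {τ : F → E} (hσ : DifferentiableOn ℂ σ U)
    (hτ : DifferentiableOn ℂ τ V) (hσUV : MapsTo σ U V) (hτVU : MapsTo τ V U)
    (hτσ : LeftInvOn τ σ U) (hστ : RightInvOn τ σ V) (h : ∀ z ∈ U, σ (φ z) = ψ (σ z)) :
    AreConjugate φ U ψ V :=
  ⟨σ, τ, hσ, hτ, hσUV, hτVU, hτσ, hστ, fun x hx => by rw [h _ (hτVU hx), hστ hx]⟩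

theorem AreConjugate.of_linearEquiv [FiniteDimensional ℂ E] (S : E ≃ₗ[ℂ] F)
    (hS : ∀ z, S z ∈ V ↔ z ∈ U) (h : ∀ z ∈ U, S (φ z) = ψ (S z)) : AreConjugate φ U ψ V :=
  have := S.finiteDimensional
  .of_semiconj S.toLinearMap.toContinuousLinearMap.differentiable.differentiableOn
    S.symm.toLinearMap.toContinuousLinearMap.differentiable.differentiableOn
    (fun z hz => (hS z).2 hz) (fun z hz => (hS _).1 ((S.apply_symm_apply z).symm ▸ hz))
    (fun z _ => S.symm_apply_apply z) (fun z _ => S.apply_symm_apply z) h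

theorem AreConjugate.trans (h₁ : AreConjugate φ U ψ V) (h₂ : AreConjugate ψ V χ W) :
    AreConjugate φ U χ W := by
  obtain ⟨σ₁, τ₁, hσ₁, hτ₁, hUV, hVU, hl₁, hr₁, h₁⟩ := h₁
  obtain ⟨σ₂, τ₂, hσ₂, hτ₂, hVW, hWV, hl₂, hr₂, h₂⟩ := h₂
  exact ⟨σ₂ ∘ σ₁, τ₁ ∘ τ₂, hσ₂.comp hσ₁ hUV, hτ₁.comp hτ₂ hWV, hVW.comp hUV, hVU.comp hWV,
    hl₁.comp hl₂ hUV, hr₁.comp hr₂ hWV, fun x hx => by rw [h₂ x hx, h₁ _ (hWV hx)]; rfl⟩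

theorem AreConjugate.mapsTo (h : AreConjugate φ U ψ V) (hφ : MapsTo φ U U) : MapsTo ψ V V := by
  obtain ⟨σ, τ, -, -, hUV, hVU, -, -, h⟩ := h
  exact fun x hx => h x hx ▸ hUV (hφ (hVU hx))

end Conjugacy

section Siegel

variable {E : Type*} [NormedAddCommGroup E]

/-- The Siegel half-plane `{(ζ, ω) : ‖ω‖² < Im ζ}` over `E`. -/
def siegelDomain (E : Type*) [NormedAddCommGroup E] : Set (ℂ × E) := {x | ‖x.2‖ ^ 2 < x.1.im}

/-- The defining function of the Siegel half-plane, the counterpart of `1 - ‖z‖²` on the ball. -/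
def siegelHeight (x : ℂ × E) : ℝ := x.1.im - ‖x.2‖ ^ 2

theorem siegelHeight_pos_iff {x : ℂ × E} : 0 < siegelHeight x ↔ x ∈ siegelDomain E := sub_pos

theorem im_pos_of_mem_siegelDomain {x : ℂ × E} (hx : x ∈ siegelDomain E) : 0 < x.1.im :=
  (sq_nonneg _).trans_lt hx

variable [NormedSpace ℂ E]

theorem eq_zero_and_eq_zero_of_forall_norm_smul_add_le {X : Type*} [NormedAddCommGroup X]
    [NormedSpace ℂ X] {u v : X} {G : E →ₗ[ℂ] X} {K : ℝ}
    (h : ∀ x ∈ siegelDomain E, ‖x.1 • u + G x.2 + v‖ ≤ K) : u = 0 ∧ G = 0 := by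
  have hu : u = 0 := by
    have hIu : Complex.I • u = 0 := by
      refine eq_zero_of_forall_norm_smul_add_le (v := v) (K := K) fun t ht => ?_
      have hx : ((t * Complex.I, 0) : ℂ × E) ∈ siegelDomain E := by simpa [siegelDomain] using ht
      simpa only [map_zero, add_zero, mul_smul, Complex.coe_smul] using h _ hx
    exact (smul_eq_zero_iff_right Complex.I_ne_zero).1 hIu
  refine ⟨hu, LinearMap.ext fun ω => ?_⟩
  refine eq_zero_of_forall_norm_smul_add_le (v := v) (K := K) fun t _ => ?_
  have hx : (((‖(t : ℂ) • ω‖ ^ 2 + 1 : ℝ) * Complex.I, (t : ℂ) • ω) : ℂ × E) ∈ siegelDomain E := by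
    simp only [siegelDomain, mem_ofPred_eq, Complex.im_ofReal_mul, Complex.I_im, mul_one]
    exact lt_add_one _
  simpa only [hu, smul_zero, zero_add, Complex.coe_smul, LinearMap.map_smul_of_tower] using h _ hx

/-- The affine maps `(ζ, ω) ↦ (ℓ ζ + a ω + b, M ω + c)`, to which linear fractional maps of the
ball fixing a boundary point are conjugate. -/
def siegelAffine (ℓ b : ℂ) (a : E →ₗ[ℂ] ℂ) (M : E →ₗ[ℂ] E) (c : E) (x : ℂ × E) : ℂ × E :=
  (ℓ * x.1 + a x.2 + b, M x.2 + c)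

variable {b : ℂ} {a : E →ₗ[ℂ] ℂ} {M : E →ₗ[ℂ] E} {c : E}

theorem im_eq_zero_of_mapsTo_siegelAffine {ℓ : ℂ}
    (h : MapsTo (siegelAffine ℓ b a M c) (siegelDomain E) (siegelDomain E)) : ℓ.im = 0 := by
  refine eq_zero_of_forall_mul_add_nonneg (y := ℓ.re + b.im) fun t => ?_
  have hmem : ((t + Complex.I, 0) : ℂ × E) ∈ siegelDomain E := by simp [siegelDomain]
  have him := im_pos_of_mem_siegelDomain (h hmem)
  simp only [siegelAffine, map_zero, add_zero, Complex.add_im, Complex.mul_im, Complex.add_re,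
    Complex.ofReal_re, Complex.ofReal_im, Complex.I_re, Complex.I_im] at him
  linarith

variable {ℓ : ℝ}

theorem norm_add_sq_le_of_mapsTo_siegelAffine
    (h : MapsTo (siegelAffine ℓ b a M c) (siegelDomain E) (siegelDomain E)) (ω : E) :
    ‖M ω + c‖ ^ 2 ≤ ℓ * ‖ω‖ ^ 2 + (a ω).im + b.im := by
  have hpos : ∀ s ∈ Ioi (0 : ℝ), ‖M ω + c‖ ^ 2 ≤ ℓ * (‖ω‖ ^ 2 + s) + (a ω).im + b.im := by
    intro s hs
    have hmem : (((‖ω‖ ^ 2 + s : ℝ) * Complex.I, ω) : ℂ × E) ∈ siegelDomain E := by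
      simpa only [siegelDomain, mem_ofPred_eq, mem_Ioi, Complex.im_ofReal_mul, Complex.I_im,
        mul_one, lt_add_iff_pos_right] using hs
    have himage : ‖M ω + c‖ ^ 2 < _ := h hmem
    simp only [siegelAffine, Complex.add_im, Complex.im_ofReal_mul, Complex.I_im, mul_one] at himage
    exact himage.le
  have hzero : (0 : ℝ) ∈ closure (Ioi 0) := by simp
  simpa using le_on_closure hpos (by fun_prop) (by fun_prop) hzero

theorem mul_siegelHeight_le_of_mapsTo_siegelAffine
    (h : MapsTo (siegelAffine ℓ b a M c) (siegelDomain E) (siegelDomain E)) (x : ℂ × E) :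
    ℓ * siegelHeight x ≤ siegelHeight (siegelAffine ℓ b a M c x) := by
  simp only [siegelHeight, siegelAffine, Complex.add_im, Complex.im_ofReal_mul]
  linarith [norm_add_sq_le_of_mapsTo_siegelAffine h x.2]

theorem norm_le_sqrt_mul_of_mapsTo_siegelAffine
    (h : MapsTo (siegelAffine ℓ b a M c) (siegelDomain E) (siegelDomain E)) (ω : E) :
    ‖M ω‖ ≤ √ℓ * ‖ω‖ := by
  have hpos : ∀ s ∈ Ioi (0 : ℝ),
      ‖M ω + (s : ℂ) • c‖ ^ 2 ≤ ℓ * ‖ω‖ ^ 2 + s * (a ω).im + s ^ 2 * b.im := by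
    intro s (hs : 0 < s)
    have hs' : (s : ℂ) ≠ 0 := by exact_mod_cast hs.ne'
    have hscale : M ω + (s : ℂ) • c = (s : ℂ) • (M ((s : ℂ)⁻¹ • ω) + c) := by
      rw [map_smul, smul_add, smul_inv_smul₀ hs']
    calc ‖M ω + (s : ℂ) • c‖ ^ 2 = s ^ 2 * ‖M ((s : ℂ)⁻¹ • ω) + c‖ ^ 2 := by
          rw [hscale, norm_smul, Complex.norm_of_nonneg hs.le, mul_pow]
      _ ≤ s ^ 2 * (ℓ * ‖(s : ℂ)⁻¹ • ω‖ ^ 2 + (a ((s : ℂ)⁻¹ • ω)).im + b.im) := by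
          gcongr
          exact norm_add_sq_le_of_mapsTo_siegelAffine h _
      _ = ℓ * ‖ω‖ ^ 2 + s * (a ω).im + s ^ 2 * b.im := by
          rw [map_smul a, smul_eq_mul, ← Complex.ofReal_inv, Complex.im_ofReal_mul, norm_smul,
            Complex.norm_of_nonneg (inv_nonneg.2 hs.le)]
          field_simp
  have hzero : (0 : ℝ) ∈ closure (Ioi 0) := by simp
  have hle : ‖M ω‖ ^ 2 ≤ ℓ * ‖ω‖ ^ 2 := by
    simpa using le_on_closure hpos (by fun_prop) (by fun_prop) hzero
  calc ‖M ω‖ ≤ √(ℓ * ‖ω‖ ^ 2) := Real.le_sqrt_of_sq_le hle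
    _ = √ℓ * ‖ω‖ := by rw [Real.sqrt_mul' _ (sq_nonneg _), Real.sqrt_sq (norm_nonneg _)]

end Siegel

section Cayley

open Complex (I)
open Metric (ball)

variable {V X : Type*} [NormedAddCommGroup V] [InnerProductSpace ℂ V] [AddCommGroup X] [Module ℂ X]
  {w z : V}

theorem inner_smul_add_orthogonalProjectionOnto (hw : ‖w‖ = 1) (z : V) :
    (inner ℂ w z : ℂ) • w + ((ℂ ∙ w)ᗮ.orthogonalProjectionOnto z : V) = z := by
  have h := Submodule.starProjection_add_starProjection_orthogonal (K := ℂ ∙ w) z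
  rwa [Submodule.starProjection_unit_singleton ℂ hw] at h

theorem inner_coe_orthogonal_singleton (ω : (ℂ ∙ w)ᗮ) : inner ℂ w (ω : V) = 0 :=
  Submodule.mem_orthogonal_singleton_iff_inner_right.1 ω.2

theorem norm_sq_eq_norm_inner_sq_add (hw : ‖w‖ = 1) (z : V) :
    ‖z‖ ^ 2 = ‖inner ℂ w z‖ ^ 2 + ‖(ℂ ∙ w)ᗮ.orthogonalProjectionOnto z‖ ^ 2 := by
  have h := Submodule.norm_sq_eq_add_norm_sq_starProjection z (ℂ ∙ w)
  rwa [Submodule.starProjection_unit_singleton ℂ hw, norm_smul, hw, mul_one] at h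

theorem inner_ne_one_of_mem_ball (hw : ‖w‖ = 1) (hz : z ∈ ball (0 : V) 1) : inner ℂ w z ≠ 1 := by
  intro h
  have hle := norm_inner_le_norm (𝕜 := ℂ) w z
  rw [h, hw, norm_one, one_mul] at hle
  exact (mem_ball_zero_iff.1 hz).not_ge hle

theorem one_sub_inner_ne_zero (hw : ‖w‖ = 1) (hz : z ∈ ball (0 : V) 1) : 1 - inner ℂ w z ≠ 0 :=
  sub_ne_zero.2 (inner_ne_one_of_mem_ball hw hz).symm

/-- The Cayley transform of the unit ball onto the Siegel half-plane over `w^⊥`, which sends the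
unit vector `w` to infinity. -/
noncomputable def cayley (w z : V) : ℂ × (ℂ ∙ w)ᗮ :=
  (I * (1 + inner ℂ w z) / (1 - inner ℂ w z),
    (I / (1 - inner ℂ w z)) • (ℂ ∙ w)ᗮ.orthogonalProjectionOnto z)

/-- The inverse of the Cayley transform, from the Siegel half-plane over `w^⊥` to the unit ball. -/
noncomputable def cayleyInv (w : V) (x : ℂ × (ℂ ∙ w)ᗮ) : V :=
  ((x.1 - I) / (x.1 + I)) • w + (2 / (x.1 + I)) • (x.2 : V)

theorem one_sub_norm_sq_eq_mul_siegelHeight_cayley (hw : ‖w‖ = 1) (hz : 1 - inner ℂ w z ≠ 0) :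
    1 - ‖z‖ ^ 2 = ‖1 - inner ℂ w z‖ ^ 2 * siegelHeight (cayley w z) := by
  have hnorm : ‖1 - inner ℂ w z‖ ^ 2 ≠ 0 := by simpa using hz
  have hfst : ‖1 - inner ℂ w z‖ ^ 2 * (cayley w z).1.im = 1 - ‖inner ℂ w z‖ ^ 2 := by
    rw [← Complex.normSq_eq_norm_sq] at hnorm ⊢
    rw [cayley, Complex.div_im, ← Complex.normSq_eq_norm_sq]
    field_simp
    simp only [Complex.normSq_apply, Complex.mul_im, Complex.mul_re, Complex.add_re,
      Complex.add_im, Complex.sub_re, Complex.sub_im, Complex.one_re, Complex.one_im,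
      Complex.I_re, Complex.I_im]
    ring
  have hsnd : ‖1 - inner ℂ w z‖ ^ 2 * ‖(cayley w z).2‖ ^ 2
      = ‖(ℂ ∙ w)ᗮ.orthogonalProjectionOnto z‖ ^ 2 := by
    rw [cayley, norm_smul, norm_div, Complex.norm_I, mul_pow, div_pow]
    field_simp
  rw [siegelHeight, mul_sub, hfst, hsnd, norm_sq_eq_norm_inner_sq_add hw z]
  ring

theorem mapsTo_cayley (hw : ‖w‖ = 1) :
    MapsTo (cayley w) (ball 0 1) (siegelDomain (ℂ ∙ w)ᗮ) := by
  intro z hz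
  have hpos : 0 < 1 - ‖z‖ ^ 2 :=
    sub_pos.2 ((sq_lt_one_iff₀ (norm_nonneg _)).2 (mem_ball_zero_iff.1 hz))
  rw [one_sub_norm_sq_eq_mul_siegelHeight_cayley hw (one_sub_inner_ne_zero hw hz)] at hpos
  exact siegelHeight_pos_iff.1 (pos_of_mul_pos_right hpos (sq_nonneg _))

theorem add_I_ne_zero_of_mem_siegelDomain {E : Type*} [NormedAddCommGroup E] {x : ℂ × E}
    (hx : x ∈ siegelDomain E) : x.1 + I ≠ 0 := by
  intro h
  have him := congrArg Complex.im h
  rw [Complex.add_im, Complex.I_im, Complex.zero_im] at him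
  linarith [im_pos_of_mem_siegelDomain hx]

theorem inner_cayleyInv (hw : ‖w‖ = 1) (x : ℂ × (ℂ ∙ w)ᗮ) :
    inner ℂ w (cayleyInv w x) = (x.1 - I) / (x.1 + I) := by
  rw [cayleyInv, inner_add_right, inner_smul_right, inner_smul_right,
    inner_self_eq_one_of_norm_eq_one hw, inner_coe_orthogonal_singleton, mul_one, mul_zero,
    add_zero]

theorem one_sub_inner_cayleyInv (hw : ‖w‖ = 1) {x : ℂ × (ℂ ∙ w)ᗮ}
    (hx : x ∈ siegelDomain (ℂ ∙ w)ᗮ) : 1 - inner ℂ w (cayleyInv w x) = 2 * I / (x.1 + I) := by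
  have hI := add_I_ne_zero_of_mem_siegelDomain hx
  rw [inner_cayleyInv hw]
  field_simp
  ring

theorem orthogonalProjectionOnto_cayleyInv (x : ℂ × (ℂ ∙ w)ᗮ) :
    (ℂ ∙ w)ᗮ.orthogonalProjectionOnto (cayleyInv w x) = (2 / (x.1 + I)) • x.2 := by
  rw [cayleyInv, map_add, map_smul, map_smul,
    Submodule.orthogonalProjectionOnto_orthogonalComplement_singleton_eq_zero, smul_zero, zero_add,
    Submodule.orthogonalProjectionOnto_mem_subspace_eq_self]

theorem rightInvOn_cayleyInv_cayley (hw : ‖w‖ = 1) :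
    RightInvOn (cayleyInv w) (cayley w) (siegelDomain (ℂ ∙ w)ᗮ) := by
  intro x hx
  have hI := add_I_ne_zero_of_mem_siegelDomain hx
  ext1
  · rw [cayley, one_sub_inner_cayleyInv hw hx, inner_cayleyInv hw]
    field_simp
    ring
  · rw [cayley, one_sub_inner_cayleyInv hw hx, orthogonalProjectionOnto_cayleyInv, smul_smul,
      show I / (2 * I / (x.1 + I)) * (2 / (x.1 + I)) = 1 by field_simp, one_smul]

theorem mapsTo_cayleyInv (hw : ‖w‖ = 1) :
    MapsTo (cayleyInv w) (siegelDomain (ℂ ∙ w)ᗮ) (ball 0 1) := by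
  intro x hx
  have hne : 1 - inner ℂ w (cayleyInv w x) ≠ 0 := by
    rw [one_sub_inner_cayleyInv hw hx]
    exact div_ne_zero (by simp) (add_I_ne_zero_of_mem_siegelDomain hx)
  have hpos : 0 < 1 - ‖cayleyInv w x‖ ^ 2 := by
    rw [one_sub_norm_sq_eq_mul_siegelHeight_cayley hw hne, rightInvOn_cayleyInv_cayley hw hx]
    exact mul_pos (by positivity) (siegelHeight_pos_iff.2 hx)
  rw [mem_ball_zero_iff, ← sq_lt_one_iff₀ (norm_nonneg _)]
  linarith

theorem leftInvOn_cayleyInv_cayley (hw : ‖w‖ = 1) :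
    LeftInvOn (cayleyInv w) (cayley w) (ball 0 1) := by
  intro z hz
  have hs := one_sub_inner_ne_zero hw hz
  have hadd : (cayley w z).1 + I = 2 * I / (1 - inner ℂ w z) := by
    rw [cayley]
    field_simp
    ring
  have hsub : (cayley w z).1 - I = 2 * I * inner ℂ w z / (1 - inner ℂ w z) := by
    rw [cayley]
    field_simp
    ring
  conv_rhs => rw [← inner_smul_add_orthogonalProjectionOnto hw z]
  rw [cayleyInv, hadd, hsub, cayley, Submodule.coe_smul, smul_smul]
  congr 1
  · congr 1
    field_simp
  · rw [show 2 / (2 * I / (1 - inner ℂ w z)) * (I / (1 - inner ℂ w z)) = 1 by field_simp, one_smul]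

theorem differentiableOn_cayley (hw : ‖w‖ = 1) : DifferentiableOn ℂ (cayley w) (ball 0 1) := by
  have hinner : Differentiable ℂ fun z : V => inner ℂ w z := (innerSL ℂ w).differentiable
  have hinv : DifferentiableOn ℂ (fun z : V => (1 - inner ℂ w z)⁻¹) (ball 0 1) :=
    (hinner.const_sub 1).differentiableOn.fun_inv fun z hz => one_sub_inner_ne_zero hw hz
  have hproj := ((ℂ ∙ w)ᗮ.orthogonalProjectionOnto).differentiable.differentiableOn (s := ball 0 1)
  unfold cayley
  simp only [div_eq_mul_inv]
  exact (((hinner.const_add 1).const_mul I).differentiableOn.fun_mul hinv).prodMk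
    ((hinv.const_mul I).fun_smul hproj)

theorem differentiableOn_cayleyInv (w : V) :
    DifferentiableOn ℂ (cayleyInv w) (siegelDomain (ℂ ∙ w)ᗮ) := by
  have hinv : DifferentiableOn ℂ (fun x : ℂ × (ℂ ∙ w)ᗮ => (x.1 + I)⁻¹) (siegelDomain (ℂ ∙ w)ᗮ) :=
    (differentiable_fst.add_const I).differentiableOn.fun_inv
      fun x hx => add_I_ne_zero_of_mem_siegelDomain hx
  have hsnd : Differentiable ℂ fun x : ℂ × (ℂ ∙ w)ᗮ => (x.2 : V) :=
    (ℂ ∙ w)ᗮ.subtypeL.differentiable.comp differentiable_snd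
  unfold cayleyInv
  simp only [div_eq_mul_inv]
  exact (((differentiable_fst.sub_const I).differentiableOn.fun_mul hinv).smul_const w).fun_add
    ((hinv.const_mul 2).fun_smul hsnd.differentiableOn)

theorem inv_one_sub_inner_smul_map_add (hw : ‖w‖ = 1) (hz : 1 - inner ℂ w z ≠ 0)
    (L : V →ₗ[ℂ] X) (B : X) :
    (1 - inner ℂ w z)⁻¹ • (L z + B)
      = (((cayley w z).1 + I) / (2 * I)) • (L w + B) - L (w + I • ((cayley w z).2 : V)) := by
  have hfst : ((cayley w z).1 + I) / (2 * I) = (1 - inner ℂ w z)⁻¹ := by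
    rw [cayley]
    field_simp
    ring
  have hsnd : I • ((cayley w z).2 : V)
      = -(1 - inner ℂ w z)⁻¹ • ((ℂ ∙ w)ᗮ.orthogonalProjectionOnto z : V) := by
    rw [cayley, Submodule.coe_smul, smul_smul, mul_div_assoc', Complex.I_mul_I, neg_div, one_div]
  have hdecomp : z - w = ((inner ℂ w z : ℂ) - 1) • w
      + ((ℂ ∙ w)ᗮ.orthogonalProjectionOnto z : V) := by
    conv_lhs => rw [← inner_smul_add_orthogonalProjectionOnto hw z]
    module
  have hsub : (1 - inner ℂ w z)⁻¹ • (z - w) = -(w + I • ((cayley w z).2 : V)) := by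
    rw [hsnd, hdecomp]
    match_scalars
    · field_simp
      ring
    · ring
  calc (1 - inner ℂ w z)⁻¹ • (L z + B)
      = (1 - inner ℂ w z)⁻¹ • (L w + B) + L ((1 - inner ℂ w z)⁻¹ • (z - w)) := by
        rw [map_smul, map_sub]
        module
    _ = _ := by rw [hfst, hsub, map_neg, ← sub_eq_add_neg]

theorem exists_mem_ball_sub_eq_smul (hw : ‖w‖ = 1) (ω : (ℂ ∙ w)ᗮ) :
    ∃ z ∈ ball (0 : V) 1, ∃ a : ℂ, z - w = a • ((ω : V) - I • w) := by
  have hx : ((‖ω‖ ^ 2 + 1 : ℝ) * I, ω) ∈ siegelDomain (ℂ ∙ w)ᗮ := by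
    simp only [siegelDomain, mem_ofPred_eq, Complex.im_ofReal_mul, Complex.I_im, mul_one]
    exact lt_add_one _
  refine ⟨_, mapsTo_cayleyInv hw hx, 2 / ((‖ω‖ ^ 2 + 1 : ℝ) * I + I), ?_⟩
  rw [cayleyInv]
  match_scalars
  · field_simp
    ring
  · ring

/-- The vectors `z - w`, with `z` in the ball, include multiples of `ω - I • w` for every `ω ⟂ w`,
so a functional vanishing on none of them must vanish on `w^⊥`. -/
theorem eq_inner_mul_of_forall_sub_ne_zero (hw : ‖w‖ = 1) {g : V →ₗ[ℂ] ℂ}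
    (hg : ∀ z ∈ ball (0 : V) 1, g (z - w) ≠ 0) (z : V) : g z = inner ℂ w z * g w := by
  have horth : ∀ ω : (ℂ ∙ w)ᗮ, g ω = 0 := by
    intro ω
    by_contra hω
    obtain ⟨z, hz, a, ha⟩ := exists_mem_ball_sub_eq_smul hw ((I * g w / g ω) • ω)
    refine hg z hz ?_
    rw [ha, Submodule.coe_smul, map_smul, map_sub, map_smul, map_smul, smul_eq_mul, smul_eq_mul,
      smul_eq_mul, div_mul_cancel₀ _ hω, sub_self, mul_zero]
  conv_lhs => rw [← inner_smul_add_orthogonalProjectionOnto hw z]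
  rw [map_add, map_smul, horth, add_zero, smul_eq_mul]

end Cayley

section LinearFractional

open Complex (I)
open Metric (ball)

variable {V : Type*} [NormedAddCommGroup V] [InnerProductSpace ℂ V] {φ : V → V} {L : V →ₗ[ℂ] V}
  {B C w z : V} {D : ℂ}

/-- `φ` is a self-map of the unit ball of `V`, given there by `φ z = (L z + B) / (⟨z, C⟩ + D)` with
a nonvanishing denominator. As in `IsLFTBall`, `⟨z, C⟩` is `inner ℂ C z`. -/
structure IsLinearFractionalSelfMap (φ : V → V) (L : V →ₗ[ℂ] V) (B C : V) (D : ℂ) : Prop where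
  mapsTo : MapsTo φ (ball 0 1) (ball 0 1)
  den_ne_zero : ∀ z ∈ ball (0 : V) 1, inner ℂ C z + D ≠ 0
  eq_inv_smul : ∀ z ∈ ball (0 : V) 1, φ z = (inner ℂ C z + D)⁻¹ • (L z + B)

namespace IsLinearFractionalSelfMap

theorem norm_num_lt_norm_den (h : IsLinearFractionalSelfMap φ L B C D) (hz : z ∈ ball (0 : V) 1) :
    ‖L z + B‖ < ‖inner ℂ C z + D‖ := by
  have hlt := mem_ball_zero_iff.1 (h.mapsTo hz)
  rwa [h.eq_inv_smul z hz, norm_smul, norm_inv,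
    inv_mul_lt_iff₀ (norm_pos_iff.2 (h.den_ne_zero z hz)), mul_one] at hlt

theorem den_eq_of_den_eq_zero (h : IsLinearFractionalSelfMap φ L B C D) (hw : ‖w‖ = 1)
    (hden : inner ℂ C w + D = 0) (z : V) : inner ℂ C z + D = -inner ℂ C w * (1 - inner ℂ w z) := by
  have hsub : ∀ z, inner ℂ C (z - w) = inner ℂ C z + D := fun z => by
    rw [inner_sub_right]
    linear_combination -hden
  have hvanish : inner ℂ C z = inner ℂ w z * inner ℂ C w :=
    eq_inner_mul_of_forall_sub_ne_zero hw (g := (innerSL ℂ C : V →ₗ[ℂ] ℂ))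
      (fun z hz => (hsub z).trans_ne (h.den_ne_zero z hz)) z
  linear_combination hvanish + hden

/-- Divided by `1 - ⟨w, z⟩`, the numerator would stay bounded by `|⟨w, C⟩|` on the ball; being
affine in the coordinates of the Siegel half-plane, it would be constant. -/
theorem apply_eq_of_den_eq_zero (h : IsLinearFractionalSelfMap φ L B C D) (hw : ‖w‖ = 1)
    (hden : inner ℂ C w + D = 0) (hz : z ∈ ball (0 : V) 1) :
    φ z = (inner ℂ C w)⁻¹ • L w := by
  have hbound : ∀ x ∈ siegelDomain (ℂ ∙ w)ᗮ,
      ‖x.1 • (2 * I)⁻¹ • (L w + B) + (-I • L ∘ₗ (ℂ ∙ w)ᗮ.subtype) x.2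
        + ((1 / 2 : ℂ) • (L w + B) - L w)‖ ≤ ‖inner ℂ C w‖ := by
    intro x hx
    have hball := mapsTo_cayleyInv hw hx
    have hne := one_sub_inner_ne_zero hw hball
    have hlt := h.norm_num_lt_norm_den hball
    rw [h.den_eq_of_den_eq_zero hw hden, norm_mul, norm_neg] at hlt
    have heq := inv_one_sub_inner_smul_map_add hw hne L B
    rw [rightInvOn_cayleyInv_cayley hw hx, map_add, map_smul] at heq
    calc _ = ‖(1 - inner ℂ w (cayleyInv w x))⁻¹ • (L (cayleyInv w x) + B)‖ := by
          rw [heq, LinearMap.smul_apply, LinearMap.comp_apply, Submodule.subtype_apply]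
          congr 1
          match_scalars <;> field_simp
          ring
      _ ≤ ‖inner ℂ C w‖ := by
          rw [norm_smul, norm_inv, inv_mul_le_iff₀ (norm_pos_iff.2 hne), mul_comm]
          exact hlt.le
  obtain ⟨hnum, hker⟩ := eq_zero_and_eq_zero_of_forall_norm_smul_add_le hbound
  replace hnum : L w + B = 0 := (smul_eq_zero_iff_right (by simp)).1 hnum
  have horth (ω : (ℂ ∙ w)ᗮ) : L ω = 0 :=
    (smul_eq_zero_iff_right (neg_ne_zero.2 Complex.I_ne_zero)).1 (LinearMap.congr_fun hker ω)
  have hz1 := one_sub_inner_ne_zero hw hz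
  have hLz : L z + B = (inner ℂ w z - 1 : ℂ) • L w := by
    conv_lhs => rw [← inner_smul_add_orthogonalProjectionOnto hw z]
    rw [map_add, map_smul, horth, add_zero, eq_neg_of_add_eq_zero_right hnum]
    module
  rw [h.eq_inv_smul z hz, hLz, h.den_eq_of_den_eq_zero hw hden, smul_smul]
  congr 1
  field_simp
  ring

theorem den_ne_zero_of_norm_eq_one (h : IsLinearFractionalSelfMap φ L B C D)
    (hfix : ∀ z ∈ ball (0 : V) 1, φ z ≠ z) (hw : ‖w‖ = 1) : inner ℂ C w + D ≠ 0 := by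
  intro hden
  have hzero : (0 : V) ∈ ball 0 1 := by simp
  refine hfix (φ 0) (h.mapsTo hzero) ?_
  rw [h.apply_eq_of_den_eq_zero hw hden (h.mapsTo hzero), h.apply_eq_of_den_eq_zero hw hden hzero]

theorem num_eq_of_tendsto_iterate (h : IsLinearFractionalSelfMap φ L B C D) (hL : Continuous L)
    (hz : z ∈ ball (0 : V) 1) (hlim : Tendsto (fun n => φ^[n] z) atTop (𝓝 w))
    (hden : inner ℂ C w + D ≠ 0) : L w + B = (inner ℂ C w + D) • w := by
  have himage : Tendsto (fun n => (inner ℂ C (φ^[n] z) + D)⁻¹ • (L (φ^[n] z) + B)) atTop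
      (𝓝 ((inner ℂ C w + D)⁻¹ • (L w + B))) := by
    refine Tendsto.smul (Tendsto.inv₀ ?_ hden) (((hL.tendsto w).comp hlim).add_const B)
    exact (((innerSL ℂ C).continuous.tendsto w).comp hlim).add_const D
  have hsucc : Tendsto (fun n => φ^[n + 1] z) atTop (𝓝 w) := (tendsto_add_atTop_iff_nat 1).2 hlim
  have heq := tendsto_nhds_unique (hsucc.congr fun n => by
    rw [Function.iterate_succ_apply', h.eq_inv_smul _ (h.mapsTo.iterate n hz)]) himage
  exact (inv_smul_eq_iff₀ hden).1 heq.symm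

theorem exists_one_sub_inner_apply_eq (h : IsLinearFractionalSelfMap φ L B C D) (hw : ‖w‖ = 1)
    (hnum : L w + B = (inner ℂ C w + D) • w) :
    ∃ α : ℂ, α ≠ 0 ∧ ∀ z ∈ ball (0 : V) 1,
      1 - inner ℂ w (φ z) = α * (1 - inner ℂ w z) / (inner ℂ C z + D) := by
  set g : V →ₗ[ℂ] ℂ := (innerSL ℂ C : V →ₗ[ℂ] ℂ) - (innerSL ℂ w : V →ₗ[ℂ] ℂ) ∘ₗ L with hg
  have hgz : ∀ z ∈ ball (0 : V) 1,
      1 - inner ℂ w (φ z) = g (z - w) / (inner ℂ C z + D) := by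
    intro z hz
    have hinner := congrArg (inner ℂ w) hnum
    rw [inner_add_right, inner_smul_right, inner_self_eq_one_of_norm_eq_one hw] at hinner
    rw [eq_div_iff (h.den_ne_zero z hz), h.eq_inv_smul z hz, inner_smul_right, sub_mul,
      mul_right_comm, inv_mul_cancel₀ (h.den_ne_zero z hz), inner_add_right]
    simp only [hg, map_sub, LinearMap.sub_apply, LinearMap.comp_apply, ContinuousLinearMap.coe_coe,
      innerSL_apply_apply]
    linear_combination -hinner
  have hne : ∀ z ∈ ball (0 : V) 1, g (z - w) ≠ 0 := fun z hz hzero => by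
    have := hgz z hz
    rw [hzero, zero_div] at this
    exact one_sub_inner_ne_zero hw (h.mapsTo hz) this
  refine ⟨-g w, ?_, fun z hz => ?_⟩
  · simpa using hne 0 (by simp)
  · rw [hgz z hz, map_sub, eq_inner_mul_of_forall_sub_ne_zero hw hne z]
    ring

end IsLinearFractionalSelfMap

end LinearFractional

section BoundaryDilation

open Complex (I)
open Metric (ball)

variable {V : Type*} [NormedAddCommGroup V] [InnerProductSpace ℂ V] {φ : V → V} {w : V}

theorem areConjugate_siegelAffine {ℓ b : ℂ} {a : (ℂ ∙ w)ᗮ →ₗ[ℂ] ℂ}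
    {M : (ℂ ∙ w)ᗮ →ₗ[ℂ] (ℂ ∙ w)ᗮ} {c : (ℂ ∙ w)ᗮ} (hw : ‖w‖ = 1)
    (hconj : ∀ z ∈ ball (0 : V) 1, cayley w (φ z) = siegelAffine ℓ b a M c (cayley w z)) :
    AreConjugate φ (ball 0 1) (siegelAffine ℓ b a M c) (siegelDomain (ℂ ∙ w)ᗮ) :=
  .of_semiconj (differentiableOn_cayley hw) (differentiableOn_cayleyInv w) (mapsTo_cayley hw)
    (mapsTo_cayleyInv hw) (leftInvOn_cayleyInv_cayley hw) (rightInvOn_cayleyInv_cayley hw) hconj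

section Slope

variable {L : V →ₗ[ℂ] V} {B C : V} {D α : ℂ}

theorem IsLinearFractionalSelfMap.cayley_apply_eq (h : IsLinearFractionalSelfMap φ L B C D)
    (hw : ‖w‖ = 1) (hα : α ≠ 0) {z : V} (hz : z ∈ ball (0 : V) 1)
    (hslope : 1 - inner ℂ w (φ z) = α * (1 - inner ℂ w z) / (inner ℂ C z + D)) :
    cayley w (φ z) = (2 * I / α * ((1 - inner ℂ w z)⁻¹ * (inner ℂ C z + D)) - I,
      (I / α) • (ℂ ∙ w)ᗮ.orthogonalProjectionOnto ((1 - inner ℂ w z)⁻¹ • (L z + B))) := by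
  have hs := one_sub_inner_ne_zero hw hz
  have hd := h.den_ne_zero z hz
  have hφ : inner ℂ w (φ z) = 1 - α * (1 - inner ℂ w z) / (inner ℂ C z + D) := by
    rw [← hslope]
    ring
  refine Prod.ext ?_ ?_
  · rw [cayley, hslope, hφ]
    field_simp
    ring
  · change (I / (1 - inner ℂ w (φ z))) • _ = (I / α) • _
    rw [hslope, h.eq_inv_smul z hz, map_smul, map_smul, smul_smul, smul_smul]
    congr 1
    field_simp

theorem IsLinearFractionalSelfMap.exists_cayley_apply_eq (h : IsLinearFractionalSelfMap φ L B C D)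
    (hw : ‖w‖ = 1) (hnum : L w + B = (inner ℂ C w + D) • w) (hα : α ≠ 0)
    (hslope : ∀ z ∈ ball (0 : V) 1,
      1 - inner ℂ w (φ z) = α * (1 - inner ℂ w z) / (inner ℂ C z + D)) :
    ∃ (b : ℂ) (a : (ℂ ∙ w)ᗮ →ₗ[ℂ] ℂ) (M : (ℂ ∙ w)ᗮ →ₗ[ℂ] (ℂ ∙ w)ᗮ) (c : (ℂ ∙ w)ᗮ),
      ∀ z ∈ ball (0 : V) 1, cayley w (φ z)
        = siegelAffine ((inner ℂ C w + D) / α) b a M c (cayley w z) := by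
  set P : V →ₗ[ℂ] (ℂ ∙ w)ᗮ := (ℂ ∙ w)ᗮ.orthogonalProjectionOnto
  have hPw : P w = 0 := Submodule.orthogonalProjectionOnto_orthogonalComplement_singleton_eq_zero w
  refine ⟨I * (inner ℂ C w + D) / α - 2 * I / α * inner ℂ C w - I,
    (2 / α) • (innerSL ℂ C : V →ₗ[ℂ] ℂ) ∘ₗ (ℂ ∙ w)ᗮ.subtype,
    α⁻¹ • P ∘ₗ L ∘ₗ (ℂ ∙ w)ᗮ.subtype, -(I / α) • P (L w), fun z hz => ?_⟩
  have hs := one_sub_inner_ne_zero hw hz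
  have hden : (1 - inner ℂ w z)⁻¹ * (inner ℂ C z + D)
      = ((cayley w z).1 + I) / (2 * I) * (inner ℂ C w + D)
        - (inner ℂ C w + I * inner ℂ C ((cayley w z).2 : V)) := by
    simpa only [map_add, map_smul, ContinuousLinearMap.coe_coe, innerSL_apply_apply, smul_eq_mul]
      using inv_one_sub_inner_smul_map_add hw hs (innerSL ℂ C : V →ₗ[ℂ] ℂ) D
  have hproj : P ((1 - inner ℂ w z)⁻¹ • (L z + B))
      = -(P (L w) + I • P (L ((cayley w z).2 : V))) := by
    rw [inv_one_sub_inner_smul_map_add hw hs, hnum, map_sub, map_smul, map_smul, hPw, smul_zero,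
      smul_zero, zero_sub, map_add, map_add, map_smul, map_smul]
  rw [h.cayley_apply_eq hw hα hz (hslope z hz), hden]
  ext1
  · simp only [siegelAffine, LinearMap.smul_apply, LinearMap.comp_apply, Submodule.subtype_apply,
      ContinuousLinearMap.coe_coe, innerSL_apply_apply, smul_eq_mul]
    field_simp
    linear_combination -2 * inner ℂ C ((cayley w z).2 : V) * Complex.I_sq
  · change (I / α) • P _ = _
    rw [hproj]
    simp only [siegelAffine, LinearMap.smul_apply, LinearMap.comp_apply, Submodule.subtype_apply]
    match_scalars
    · ring
    · linear_combination -Complex.I_sq / α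

end Slope

theorem tendsto_cayleyInv_mul_I (hw : ‖w‖ = 1) :
    Tendsto (fun y : ℝ => cayleyInv w (y * I, 0)) atTop (𝓝[ball 0 1] w) := by
  refine tendsto_nhdsWithin_iff.2 ⟨?_, ?_⟩
  · have hlim : Tendsto (fun y : ℝ => (1 - 2 / (y + 1)) • w) atTop (𝓝 ((1 - 0 : ℝ) • w)) :=
      (tendsto_const_nhds.sub (tendsto_const_nhds.div_atTop
        (tendsto_atTop_add_const_right _ 1 tendsto_id))).smul_const w
    rw [sub_zero, one_smul] at hlim
    refine hlim.congr' ?_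
    filter_upwards [eventually_gt_atTop 0] with y hy
    have hy' : (y : ℂ) + 1 ≠ 0 := by exact_mod_cast (by positivity : y + 1 ≠ 0)
    rw [cayleyInv, Submodule.coe_zero, smul_zero, add_zero, ← Complex.coe_smul]
    congr 1
    push_cast
    field_simp
    ring
  · filter_upwards [eventually_gt_atTop 0] with y hy
    exact mapsTo_cayleyInv hw (by simpa [siegelDomain] using hy)

theorem one_sub_norm_sq_div_eq (hw : ‖w‖ = 1) (hφ : MapsTo φ (ball 0 1) (ball 0 1)) {z : V}
    (hz : z ∈ ball (0 : V) 1) :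
    (1 - ‖φ z‖ ^ 2) / (1 - ‖z‖ ^ 2) = ‖(1 - inner ℂ w (φ z)) / (1 - inner ℂ w z)‖ ^ 2
      * (siegelHeight (cayley w (φ z)) / siegelHeight (cayley w z)) := by
  rw [one_sub_norm_sq_eq_mul_siegelHeight_cayley hw (one_sub_inner_ne_zero hw hz),
    one_sub_norm_sq_eq_mul_siegelHeight_cayley hw (one_sub_inner_ne_zero hw (hφ hz)), norm_div,
    div_pow, div_mul_div_comm]

theorem liminf_one_sub_norm_sq_div_eq {ℓ : ℝ} {b : ℂ} {a : (ℂ ∙ w)ᗮ →ₗ[ℂ] ℂ}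
    {M : (ℂ ∙ w)ᗮ →ₗ[ℂ] (ℂ ∙ w)ᗮ} {c : (ℂ ∙ w)ᗮ} (hw : ‖w‖ = 1) (hℓ : ℓ ≠ 0)
    (hφ : MapsTo φ (ball 0 1) (ball 0 1))
    (hconj : ∀ z ∈ ball (0 : V) 1, cayley w (φ z) = siegelAffine ℓ b a M c (cayley w z))
    (hslope : Tendsto (fun z => (1 - inner ℂ w (φ z)) / (1 - inner ℂ w z)) (𝓝[ball 0 1] w)
      (𝓝 (ℓ : ℂ)⁻¹)) :
    liminf (fun z => (((1 - ‖φ z‖ ^ 2) / (1 - ‖z‖ ^ 2) : ℝ) : EReal)) (𝓝[ball 0 1] w)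
      = (ℓ⁻¹ : ℝ) := by
  set slope : V → ℂ := fun z => (1 - inner ℂ w (φ z)) / (1 - inner ℂ w z)
  have hψ := (areConjugate_siegelAffine hw hconj).mapsTo hφ
  have hnorm : Tendsto (fun z => ‖slope z‖ ^ 2 * ℓ) (𝓝[ball 0 1] w) (𝓝 ℓ⁻¹) := by
    convert (hslope.norm.pow 2).mul_const ℓ using 2
    rw [norm_inv, Complex.norm_real, inv_pow, Real.norm_eq_abs, sq_abs]
    field_simp
  have hpath := tendsto_cayleyInv_mul_I hw
  refine liminf_eq_of_le_of_tendsto_comp (p := fun y : ℝ => cayleyInv w (y * I, 0)) (m := atTop)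
    ((continuous_coe_real_ereal.tendsto _).comp hnorm) ?_ hpath
    ((continuous_coe_real_ereal.tendsto _).comp ?_)
  · filter_upwards [self_mem_nhdsWithin] with z hz
    have hpos : 0 < siegelHeight (cayley w z) := siegelHeight_pos_iff.2 (mapsTo_cayley hw hz)
    rw [Function.comp_apply, EReal.coe_le_coe_iff, one_sub_norm_sq_div_eq hw hφ hz, hconj z hz]
    gcongr
    rw [le_div_iff₀ hpos]
    exact mul_siegelHeight_le_of_mapsTo_siegelAffine hψ _
  · have hheight : Tendsto (fun y : ℝ => ℓ + (b.im - ‖c‖ ^ 2) / y) atTop (𝓝 (ℓ + 0)) :=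
      tendsto_const_nhds.add (tendsto_const_nhds.div_atTop tendsto_id)
    have hprod := ((hslope.norm.pow 2).comp hpath).mul hheight
    rw [add_zero, norm_inv, Complex.norm_real, inv_pow, Real.norm_eq_abs, sq_abs,
      inv_mul_eq_div, sq ℓ, div_self_mul_self'] at hprod
    refine hprod.congr' ?_
    filter_upwards [eventually_gt_atTop 0] with y hy
    have hx : ((y * I, 0) : ℂ × (ℂ ∙ w)ᗮ) ∈ siegelDomain (ℂ ∙ w)ᗮ := by
      simpa [siegelDomain] using hy
    have hz := mapsTo_cayleyInv hw hx
    rw [one_sub_norm_sq_div_eq hw hφ hz, hconj _ hz, rightInvOn_cayleyInv_cayley hw hx]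
    refine congrArg (‖slope _‖ ^ 2 * ·) ?_
    simp only [siegelHeight, siegelAffine, map_zero, add_zero, zero_add, Complex.add_im,
      Complex.im_ofReal_mul, Complex.I_im, mul_one, norm_zero, zero_pow two_ne_zero, sub_zero]
    field_simp
    ring

theorem IsLinearFractionalSelfMap.exists_siegelAffine {L : V →ₗ[ℂ] V} {B C : V} {D : ℂ}
    (h : IsLinearFractionalSelfMap φ L B C D) (hw : ‖w‖ = 1)
    (hnum : L w + B = (inner ℂ C w + D) • w) (hden : inner ℂ C w + D ≠ 0) :
    ∃ (ℓ : ℝ) (b : ℂ) (a : (ℂ ∙ w)ᗮ →ₗ[ℂ] ℂ) (M : (ℂ ∙ w)ᗮ →ₗ[ℂ] (ℂ ∙ w)ᗮ) (c : (ℂ ∙ w)ᗮ),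
      ℓ ≠ 0 ∧
      (∀ z ∈ ball (0 : V) 1, cayley w (φ z) = siegelAffine ℓ b a M c (cayley w z)) ∧
      Tendsto (fun z => (1 - inner ℂ w (φ z)) / (1 - inner ℂ w z)) (𝓝[ball 0 1] w)
        (𝓝 (ℓ : ℂ)⁻¹) := by
  obtain ⟨α, hα, hslope⟩ := h.exists_one_sub_inner_apply_eq hw hnum
  obtain ⟨b, a, M, c, hconj⟩ := h.exists_cayley_apply_eq hw hnum hα hslope
  obtain ⟨ℓ, hℓ⟩ : ∃ ℓ : ℝ, (inner ℂ C w + D) / α = ℓ :=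
    ⟨_, (Complex.conj_eq_iff_re.1 (Complex.conj_eq_iff_im.2 (im_eq_zero_of_mapsTo_siegelAffine
      ((areConjugate_siegelAffine hw hconj).mapsTo h.mapsTo)))).symm⟩
  have hlim : Tendsto (fun z => α / (inner ℂ C z + D)) (𝓝[ball 0 1] w) (𝓝 (ℓ : ℂ)⁻¹) := by
    rw [← hℓ, inv_div]
    exact tendsto_const_nhds.div
      ((((innerSL ℂ C).continuous.add_const D).tendsto w).mono_left nhdsWithin_le_nhds) hden
  refine ⟨ℓ, b, a, M, c, ?_, hℓ ▸ hconj, hlim.congr' ?_⟩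
  · exact_mod_cast hℓ ▸ div_ne_zero hden hα
  · filter_upwards [self_mem_nhdsWithin] with z hz
    rw [hslope z hz, div_right_comm, mul_div_cancel_right₀ _ (one_sub_inner_ne_zero hw hz)]

end BoundaryDilation

section Contraction

open Module.End
  (Eigenvalues HasEigenvalue eigenspace hasEigenvalue_of_hasEigenvector mem_eigenspace_iff)

theorem surjective_smul_id_sub {𝕜 F : Type*} [NormedField 𝕜] [NormedAddCommGroup F]
    [NormedSpace 𝕜 F] [FiniteDimensional 𝕜 F] {T : F →ₗ[𝕜] F} {K : ℝ} {μ : 𝕜}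
    (hT : ∀ x, ‖T x‖ ≤ K * ‖x‖) (hμ : K < ‖μ‖) :
    Function.Surjective (μ • LinearMap.id - T : F →ₗ[𝕜] F) := by
  rw [← LinearMap.injective_iff_surjective, injective_iff_map_eq_zero]
  intro x hx
  have hTx : μ • x = T x := by simpa [sub_eq_zero] using hx
  have hle : ‖μ‖ * ‖x‖ ≤ K * ‖x‖ := by
    rw [← norm_smul, hTx]
    exact hT x
  by_contra hne
  exact hμ.not_ge (le_of_mul_le_mul_right hle (norm_pos_iff.2 hne))

variable {𝕜 E : Type*} [RCLike 𝕜] [NormedAddCommGroup E] [InnerProductSpace 𝕜 E]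

theorem inner_apply_eq_zero_of_norm_eq {F : Type*} [NormedAddCommGroup F] [InnerProductSpace 𝕜 F]
    {T : E →ₗ[𝕜] F} {c : F} {β : ℝ} (h : ∀ x, ‖T x + c‖ ^ 2 ≤ ‖x‖ ^ 2 + β) {x : E}
    (hx : ‖T x‖ = ‖x‖) : inner 𝕜 (T x) c = 0 := by
  set s := inner 𝕜 (T x) c with hs
  have hlin : ∀ t : ℝ, 0 ≤ -2 * ‖s‖ ^ 2 * t + (β - ‖c‖ ^ 2) := by
    intro t
    have hcross : RCLike.re (inner 𝕜 (((t : 𝕜) * s) • T x) c) = t * ‖s‖ ^ 2 := by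
      rw [inner_smul_left, ← hs, map_mul (starRingEnd 𝕜), RCLike.conj_ofReal, mul_assoc,
        RCLike.conj_mul]
      exact_mod_cast RCLike.ofReal_re (K := 𝕜) _
    have hle := h (((t : 𝕜) * s) • x)
    rw [map_smul, norm_add_sq (𝕜 := 𝕜), hcross, norm_smul, norm_smul, hx] at hle
    linarith
  have hzero := eq_zero_of_forall_mul_add_nonneg hlin
  simpa using hzero

variable [FiniteDimensional 𝕜 E] {T : E →ₗ[𝕜] E}

theorem norm_adjoint_apply_le {K : ℝ} (hT : ∀ x, ‖T x‖ ≤ K * ‖x‖) (x : E) :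
    ‖T.adjoint x‖ ≤ K * ‖x‖ := by
  rcases eq_or_ne (T.adjoint x) 0 with h0 | h0
  · rw [h0, norm_zero]
    exact (norm_nonneg _).trans (hT x)
  refine le_of_mul_le_mul_left ?_ (norm_pos_iff.2 h0)
  calc ‖T.adjoint x‖ * ‖T.adjoint x‖ = ‖inner 𝕜 x (T (T.adjoint x))‖ := by
        rw [← LinearMap.adjoint_inner_left, ← inner_self_re_eq_norm, inner_self_eq_norm_mul_norm]
    _ ≤ ‖x‖ * ‖T (T.adjoint x)‖ := norm_inner_le_norm _ _
    _ ≤ ‖x‖ * (K * ‖T.adjoint x‖) := by gcongr; exact hT _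
    _ = ‖T.adjoint x‖ * (K * ‖x‖) := by ring

theorem adjoint_apply_of_norm_eq_one (hT : ∀ x, ‖T x‖ ≤ ‖x‖) {x : E} {μ : 𝕜} (hμ : ‖μ‖ = 1)
    (hx : T x = μ • x) : T.adjoint x = (starRingEnd 𝕜 μ) • x := by
  have hcross : RCLike.re (inner 𝕜 (T.adjoint x) ((starRingEnd 𝕜 μ) • x)) = ‖x‖ ^ 2 := by
    rw [LinearMap.adjoint_inner_left, map_smul, hx, smul_smul, RCLike.conj_mul, hμ,
      RCLike.ofReal_one, one_pow, one_smul, inner_self_eq_norm_sq]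
  have hadj : ‖T.adjoint x‖ ≤ ‖x‖ := by
    simpa using norm_adjoint_apply_le (K := 1) (by simpa using hT) x
  have hsq : ‖T.adjoint x - (starRingEnd 𝕜 μ) • x‖ ^ 2 ≤ 0 := by
    rw [norm_sub_sq (𝕜 := 𝕜), hcross, norm_smul, RCLike.norm_conj, hμ, one_mul]
    linarith [pow_le_pow_left₀ (norm_nonneg _) hadj 2]
  rw [← sub_eq_zero, ← norm_eq_zero]
  exact sq_eq_zero_iff.1 (hsq.antisymm (sq_nonneg _))

theorem inner_eq_zero_of_apply_eq_smul (hT : ∀ x, ‖T x‖ ≤ ‖x‖) {x y : E} {μ ν : 𝕜}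
    (hμ : ‖μ‖ = 1) (hμν : μ ≠ ν) (hx : T x = μ • x) (hy : T y = ν • y) : inner 𝕜 x y = 0 := by
  have hinner := LinearMap.adjoint_inner_left T y x
  rw [adjoint_apply_of_norm_eq_one hT hμ hx, hy, inner_smul_left, inner_smul_right,
    RCLike.conj_conj] at hinner
  exact (mul_eq_mul_right_iff.1 hinner).resolve_left hμν

theorem orthogonalFamily_eigenspace_of_norm_eq_one (hT : ∀ x, ‖T x‖ ≤ ‖x‖) :
    OrthogonalFamily 𝕜 (fun μ : {μ : Eigenvalues T // ‖(μ : 𝕜)‖ = 1} => eigenspace T μ)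
      fun μ => (eigenspace T μ).subtypeₗᵢ := fun μ _ hμν x y =>
  inner_eq_zero_of_apply_eq_smul hT μ.2 (fun h => hμν (Subtype.ext (Subtype.ext h)))
    (mem_eigenspace_iff.1 x.2) (mem_eigenspace_iff.1 y.2)

theorem exists_orthonormal_eigenvectors_norm_eq_one (hT : ∀ x, ‖T x‖ ≤ ‖x‖) :
    ∃ (n : ℕ) (v : Fin n → E) (μ : Fin n → 𝕜), Orthonormal 𝕜 v ∧ (∀ i, ‖μ i‖ = 1) ∧
      (∀ i, T (v i) = μ i • v i) ∧
      ∀ ⦃x : E⦄ ⦃ν : 𝕜⦄, ‖ν‖ = 1 → T x = ν • x → (∀ i, inner 𝕜 (v i) x = 0) → x = 0 := by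
  classical
  let u (μ : {μ : Eigenvalues T // ‖(μ : 𝕜)‖ = 1}) := stdOrthonormalBasis 𝕜 (eigenspace T μ)
  let e := Fintype.equivFin (Σ μ : {μ : Eigenvalues T // ‖(μ : 𝕜)‖ = 1},
    Fin (Module.finrank 𝕜 (eigenspace T μ)))
  have hu_orthonormal := (orthogonalFamily_eigenspace_of_norm_eq_one
    hT).orthonormal_sigma_orthonormal fun μ => (u μ).orthonormal
  refine ⟨_, fun i => u _ (e.symm i).2, fun i => (e.symm i).1,
    hu_orthonormal.comp _ e.symm.injective, fun i => (e.symm i).1.2,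
    fun i => mem_eigenspace_iff.1 (u _ (e.symm i).2).2, fun x ν hν hx hvx => ?_⟩
  have hu : ∀ μ i, inner 𝕜 (u μ i : E) x = 0 := fun μ i =>
    e.symm.surjective.forall (p := fun k => inner 𝕜 (u k.1 k.2 : E) x = 0).2 hvx ⟨μ, i⟩
  by_contra hx0
  have hν_eigen : HasEigenvalue T ν :=
    hasEigenvalue_of_hasEigenvector ⟨mem_eigenspace_iff.2 hx, hx0⟩
  let μ : {μ : Eigenvalues T // ‖(μ : 𝕜)‖ = 1} := ⟨⟨ν, hν_eigen⟩, hν⟩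
  have hmem : x ∈ eigenspace T μ := mem_eigenspace_iff.2 hx
  have hzero : (⟨x, hmem⟩ : eigenspace T μ) = 0 := by
    refine InnerProductSpace.ext_inner_left_basis (u μ).toBasis fun i => ?_
    simpa using hu μ i
  exact hx0 (congrArg Subtype.val hzero)

theorem exists_orthonormalBasis_inl_eq {ι : Type*} [Fintype ι] {v : ι → E}
    (hv : Orthonormal 𝕜 v) :
    ∃ (r : ℕ) (b : OrthonormalBasis (ι ⊕ Fin r) 𝕜 E), ∀ i, b (.inl i) = v i := by
  have hcard := hv.linearIndependent.fintype_card_le_finrank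
  let r := Module.finrank 𝕜 E - Fintype.card ι
  let f : ι ⊕ Fin r → E := Sum.elim v 0
  let e := Equiv.ofInjective (Sum.inl : ι → ι ⊕ Fin r) Sum.inl_injective
  have hrange : Orthonormal 𝕜 ((range (Sum.inl : ι → ι ⊕ Fin r)).domRestrict f) := by
    convert hv.comp _ e.symm.injective
    ext ⟨_, i, rfl⟩
    simp [e, f]
  obtain ⟨b, hb⟩ := hrange.exists_orthonormalBasis_extension_of_card_eq (by
    rw [Fintype.card_sum, Fintype.card_fin, Nat.add_sub_cancel' hcard])
  exact ⟨r, b, fun i => hb _ (mem_range_self i)⟩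

/-- In the orthonormal basis `B`, the operator `T` fixes the first block of vectors, acts on the
second block as the diagonal unitary with entries `μ i ≠ 1`, and has only eigenvalues of modulus
less than one on the orthogonal complement of these two blocks. -/
structure IsUnimodularSplitting {p q r : ℕ} (T : E →ₗ[𝕜] E)
    (B : OrthonormalBasis (Fin p ⊕ Fin q ⊕ Fin r) 𝕜 E) (μ : Fin q → 𝕜) : Prop where
  apply_inl : ∀ i, T (B (.inl i)) = B (.inl i)
  apply_inr_inl : ∀ i, T (B (.inr (.inl i))) = μ i • B (.inr (.inl i))
  norm_eq_one : ∀ i, ‖μ i‖ = 1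
  ne_one : ∀ i, μ i ≠ 1
  norm_lt_one : ∀ ⦃x : E⦄ ⦃ν : 𝕜⦄, x ≠ 0 → T x = ν • x → (∀ i, inner 𝕜 (B (.inl i)) x = 0) →
    (∀ i, inner 𝕜 (B (.inr (.inl i))) x = 0) → ‖ν‖ < 1

theorem exists_isUnimodularSplitting (hT : ∀ x, ‖T x‖ ≤ ‖x‖) :
    ∃ (p q r : ℕ) (B : OrthonormalBasis (Fin p ⊕ Fin q ⊕ Fin r) 𝕜 E) (μ : Fin q → 𝕜),
      IsUnimodularSplitting T B μ := by
  classical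
  obtain ⟨n, v, μ, hv, hμ, hTv, hmax⟩ := exists_orthonormal_eigenvectors_norm_eq_one hT
  obtain ⟨r, b, hb⟩ := exists_orthonormalBasis_inl_eq hv
  let e₁ := Fintype.equivFin {i // μ i = 1}
  let e₂ := Fintype.equivFin {i // ¬ μ i = 1}
  let e := (((Equiv.sumCompl fun i => μ i = 1).symm.trans (e₁.sumCongr e₂)).sumCongr
    (Equiv.refl (Fin r))).trans (Equiv.sumAssoc _ _ _)
  have hB₁ : ∀ i, b.reindex e (.inl i) = v (e₁.symm i) := fun i => by simp [e, ← hb]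
  have hB₂ : ∀ i, b.reindex e (.inr (.inl i)) = v (e₂.symm i) := fun i => by simp [e, ← hb]
  refine ⟨_, _, r, b.reindex e, fun i => μ (e₂.symm i), fun i => ?_, fun i => ?_,
    fun i => hμ _, fun i => (e₂.symm i).2, fun x ν hx hTx h₁ h₂ => ?_⟩
  · rw [hB₁, hTv, (e₁.symm i).2, one_smul]
  · rw [hB₂, hTv]
  · refine lt_of_le_of_ne ?_ fun hν => hx (hmax hν hTx fun i => ?_)
    · have hle := hT x
      rw [hTx, norm_smul] at hle
      exact le_of_mul_le_mul_right (by rwa [one_mul]) (norm_pos_iff.2 hx)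
    · by_cases hi : μ i = 1
      · simpa [hB₁] using h₁ (e₁ ⟨i, hi⟩)
      · simpa [hB₂] using h₂ (e₂ ⟨i, hi⟩)

end Contraction

section Heisenberg

open Complex (I)

variable {E : Type*} [NormedAddCommGroup E] [InnerProductSpace ℂ E]

/-- The Heisenberg translation by `γ`, an automorphism of the Siegel half-plane. -/
noncomputable def heisenberg (γ : E) (x : ℂ × E) : ℂ × E :=
  (x.1 + 2 * I * inner ℂ γ x.2 + I * (‖γ‖ ^ 2 : ℝ), x.2 + γ)

theorem siegelHeight_heisenberg (γ : E) (x : ℂ × E) :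
    siegelHeight (heisenberg γ x) = siegelHeight x := by
  have hsq : ‖x.2 + γ‖ ^ 2 = ‖x.2‖ ^ 2 + 2 * (inner ℂ γ x.2).re + ‖γ‖ ^ 2 := by
    rw [add_comm x.2, norm_add_sq (𝕜 := ℂ), RCLike.re_to_complex]
    ring
  simp only [siegelHeight, heisenberg, hsq, Complex.add_im, Complex.mul_im, Complex.I_re,
    Complex.I_im, Complex.ofReal_re, Complex.ofReal_im, Complex.mul_re, Complex.re_ofNat,
    Complex.im_ofNat]
  ring

theorem mapsTo_heisenberg (γ : E) : MapsTo (heisenberg γ) (siegelDomain E) (siegelDomain E) :=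
  fun x hx => siegelHeight_pos_iff.1 (siegelHeight_heisenberg γ x ▸ siegelHeight_pos_iff.2 hx)

theorem leftInverse_heisenberg_neg (γ : E) :
    Function.LeftInverse (heisenberg (-γ)) (heisenberg γ) := by
  intro x
  have hself : inner ℂ γ γ = ((‖γ‖ ^ 2 : ℝ) : ℂ) := by
    rw [inner_self_eq_norm_sq_to_K]
    norm_cast
  ext1
  · simp only [heisenberg, inner_neg_left, inner_add_right, norm_neg, hself]
    ring
  · exact add_neg_cancel_right _ _

theorem differentiable_heisenberg (γ : E) : Differentiable ℂ (heisenberg γ) := by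
  have hinner : Differentiable ℂ fun x : ℂ × E => inner ℂ γ x.2 :=
    (innerSL ℂ γ).differentiable.comp differentiable_snd
  unfold heisenberg
  fun_prop

theorem exists_siegelAffine_comp_heisenberg [FiniteDimensional ℂ E] {M : E →ₗ[ℂ] E} {ℓ : ℂ} {K : ℝ}
    (hM : ∀ ω, ‖M ω‖ ≤ K * ‖ω‖) (hK : K < ‖ℓ‖) (b : ℂ) (a : E →ₗ[ℂ] ℂ) (c : E) :
    ∃ (γ : E) (b' : ℂ) (c' : E),
      siegelAffine ℓ b a M c ∘ heisenberg γ = heisenberg γ ∘ siegelAffine ℓ b' 0 M c' := by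
  set α := (InnerProductSpace.toDual ℂ E).symm (LinearMap.toContinuousLinearMap a) with hα
  have ha : ∀ ω, a ω = inner ℂ α ω := fun ω => by simp [hα]
  obtain ⟨γ, hγ⟩ := surjective_smul_id_sub (μ := starRingEnd ℂ ℓ) (norm_adjoint_apply_le hM)
    (by rwa [RCLike.norm_conj]) (-(I / 2) • α)
  have hcancel : ∀ ω, 2 * I * (ℓ * inner ℂ γ ω) + a ω = 2 * I * inner ℂ γ (M ω) := by
    intro ω
    have hinner := congrArg (inner ℂ · ω) hγ
    simp only [LinearMap.sub_apply, LinearMap.smul_apply, LinearMap.id_apply, inner_sub_left,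
      inner_smul_left, LinearMap.adjoint_inner_left, map_neg, map_div₀, Complex.conj_I,
      Complex.conj_conj, Complex.conj_ofNat, ← ha] at hinner
    linear_combination 2 * I * hinner + a ω * Complex.I_sq
  set c' := M γ + c - γ with hc'
  refine ⟨γ, ℓ * I * (‖γ‖ ^ 2 : ℝ) + a γ + b - 2 * I * inner ℂ γ c' - I * (‖γ‖ ^ 2 : ℝ), c',
    funext fun x => ?_⟩
  ext1
  · simp only [Function.comp_apply, siegelAffine, heisenberg, map_add, inner_add_right,
      LinearMap.zero_apply]
    linear_combination hcancel x.2
  · simp only [Function.comp_apply, siegelAffine, heisenberg, map_add, hc']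
    abel

theorem exists_areConjugate_siegelAffine_zero [FiniteDimensional ℂ E] {ℓ : ℝ} (hℓ : 1 < ℓ) {b : ℂ}
    {a : E →ₗ[ℂ] ℂ} {M : E →ₗ[ℂ] E} {c : E}
    (h : MapsTo (siegelAffine ℓ b a M c) (siegelDomain E) (siegelDomain E)) :
    ∃ (b' : ℂ) (c' : E), AreConjugate (siegelAffine ℓ b a M c) (siegelDomain E)
      (siegelAffine ℓ b' 0 M c') (siegelDomain E) := by
  have hsqrt : √ℓ < ‖(ℓ : ℂ)‖ := by
    rw [Complex.norm_of_nonneg (by linarith), Real.sqrt_lt' (by linarith)]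
    nlinarith
  obtain ⟨γ, b', c', hγ⟩ :=
    exists_siegelAffine_comp_heisenberg (norm_le_sqrt_mul_of_mapsTo_siegelAffine h) hsqrt b a c
  have hright : Function.LeftInverse (heisenberg γ) (heisenberg (-γ)) := by
    simpa only [neg_neg] using leftInverse_heisenberg_neg (-γ)
  refine ⟨b', c', .of_semiconj (σ := heisenberg (-γ)) (τ := heisenberg γ)
    (differentiable_heisenberg _).differentiableOn (differentiable_heisenberg _).differentiableOn
    (mapsTo_heisenberg _) (mapsTo_heisenberg _) (fun x _ => hright x)
    (fun x _ => leftInverse_heisenberg_neg γ x) fun x _ => ?_⟩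
  have hx := congrFun hγ (heisenberg (-γ) x)
  simp only [Function.comp_apply, hright x] at hx
  rw [hx, leftInverse_heisenberg_neg]

end Heisenberg

section PseudoInverse

variable {n : ℕ} {A H : Matrix (Fin n) (Fin n) ℂ}

theorem matVec_mul (A B : Matrix (Fin n) (Fin n) ℂ) (x : CSpace n) :
    matVec (A * B) x = matVec A (matVec B x) := by
  simp [matVec, Matrix.mulVec_mulVec]

theorem matVec_one_sub (A : Matrix (Fin n) (Fin n) ℂ) (x : CSpace n) :
    matVec (1 - A) x = x - matVec A x := by
  ext i
  simp [matVec, Matrix.sub_mulVec]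

theorem inner_matVec_left (A : Matrix (Fin n) (Fin n) ℂ) (x y : CSpace n) :
    inner ℂ (matVec A x) y = inner ℂ x (matVec Aᴴ y) := by
  change inner ℂ (Matrix.toEuclideanLin A x) y = inner ℂ x (Matrix.toEuclideanLin Aᴴ y)
  rw [Matrix.toEuclideanLin_conjTranspose_eq_adjoint, LinearMap.adjoint_inner_right]

theorem norm_matVec_conjTranspose_le (hA : ∀ x, ‖matVec A x‖ ≤ ‖x‖) (x : CSpace n) :
    ‖matVec Aᴴ x‖ ≤ ‖x‖ := by
  change ‖Matrix.toEuclideanLin Aᴴ x‖ ≤ ‖x‖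
  rw [Matrix.toEuclideanLin_conjTranspose_eq_adjoint]
  simpa only [one_mul] using
    norm_adjoint_apply_le (T := Matrix.toEuclideanLin A) (K := 1) (by simpa only [one_mul]) x

theorem inner_one_sub_conjTranspose_mul_self (A : Matrix (Fin n) (Fin n) ℂ) (x : CSpace n) :
    inner ℂ (matVec (1 - Aᴴ * A) x) x = ((‖x‖ ^ 2 - ‖matVec A x‖ ^ 2 : ℝ) : ℂ) := by
  rw [matVec_one_sub, matVec_mul, inner_sub_left, inner_matVec_left,
    Matrix.conjTranspose_conjTranspose, inner_self_eq_norm_sq_to_K, inner_self_eq_norm_sq_to_K]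
  norm_cast

theorem posSemidef_one_sub_conjTranspose_mul_self (hA : ∀ x, ‖matVec A x‖ ≤ ‖x‖) :
    (1 - Aᴴ * A).PosSemidef := by
  rw [← Matrix.isPositive_toEuclideanLin_iff, LinearMap.isPositive_iff_complex]
  intro x
  have hx : inner ℂ (Matrix.toEuclideanLin (1 - Aᴴ * A) x) x = _ :=
    inner_one_sub_conjTranspose_mul_self A x
  rw [hx, RCLike.re_to_complex, Complex.ofReal_re]
  exact ⟨rfl, sub_nonneg.2 (pow_le_pow_left₀ (norm_nonneg _) (hA x) 2)⟩

theorem matVec_mul_pseudoInv_of_forall_inner_eq_zero (hH : H.IsHermitian) {v : CSpace n}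
    (hv : ∀ x, matVec H x = 0 → inner ℂ x v = 0) : matVec (H * pseudoInv H) v = v := by
  have hp := isPseudoInverse_pseudoInv H
  have hHR : H * (H * pseudoInv H) = H := by
    have hadj := congrArg Matrix.conjTranspose hp.mul_mul_left
    rwa [Matrix.conjTranspose_mul, hp.herm_left.eq, hH.eq] at hadj
  set x := v - matVec (H * pseudoInv H) v with hx
  have hker : matVec H x = 0 := by
    have hsub : matVec H x = matVec H v - matVec H (matVec (H * pseudoInv H) v) :=
      map_sub (Matrix.toEuclideanLin H) _ _
    rw [hsub, ← matVec_mul, hHR, sub_self]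
  have hrange : inner ℂ x (matVec (H * pseudoInv H) v) = 0 := by
    rw [matVec_mul, ← hH.eq, ← inner_matVec_left, hH.eq, hker, inner_zero_left]
  have hself : inner ℂ x x = 0 := by
    nth_rw 2 [hx]
    rw [inner_sub_right, hv x hker, hrange, sub_zero]
  exact (sub_eq_zero.1 (inner_self_eq_zero.1 hself)).symm

theorem inner_matVec_pseudoInv_of_matVec_eq (hH : H.IsHermitian) {y c : CSpace n}
    (hy : matVec H y = c) : inner ℂ c (matVec (pseudoInv H) c) = inner ℂ y c := by
  nth_rw 1 [← hy]
  rw [inner_matVec_left, hH.eq, ← hy, ← matVec_mul, ← matVec_mul,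
    (isPseudoInverse_pseudoInv H).mul_mul_left]

variable {c : CSpace n} {β : ℝ}

theorem matVec_one_sub_mul_pseudoInv_of_norm_add_sq_le
    (h : ∀ x, ‖matVec A x + c‖ ^ 2 ≤ ‖x‖ ^ 2 + β) :
    matVec ((1 - Aᴴ * A) * pseudoInv (1 - Aᴴ * A) * Aᴴ) c = matVec Aᴴ c := by
  rw [matVec_mul]
  refine matVec_mul_pseudoInv_of_forall_inner_eq_zero
    (Matrix.isHermitian_one.sub (Matrix.isHermitian_conjTranspose_mul_self A)) fun x hx => ?_
  have hnorm := inner_one_sub_conjTranspose_mul_self A x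
  rw [hx, inner_zero_left, eq_comm, Complex.ofReal_eq_zero, sub_eq_zero,
    pow_left_inj₀ (norm_nonneg _) (norm_nonneg _) two_ne_zero] at hnorm
  rw [← inner_matVec_left]
  exact inner_apply_eq_zero_of_norm_eq (T := Matrix.toEuclideanLin A) h hnorm.symm

theorem inner_pseudoInv_one_sub_le_of_norm_add_sq_le
    (h : ∀ x, ‖matVec A x + c‖ ^ 2 ≤ ‖x‖ ^ 2 + β) :
    (inner ℂ c (matVec (pseudoInv (1 - A * Aᴴ)) c)).re ≤ β := by
  set x := matVec (pseudoInv (1 - Aᴴ * A)) (matVec Aᴴ c) with hx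
  have hQx : matVec (1 - Aᴴ * A) x = matVec Aᴴ c := by
    rw [hx, ← matVec_mul, ← matVec_mul, matVec_one_sub_mul_pseudoInv_of_norm_add_sq_le h]
  have hPy : matVec (1 - A * Aᴴ) (c + matVec A x) = c := by
    have hadd : matVec Aᴴ (c + matVec A x) = matVec Aᴴ c + matVec Aᴴ (matVec A x) :=
      map_add (Matrix.toEuclideanLin Aᴴ) _ _
    rw [matVec_one_sub, matVec_mul] at hQx
    rw [matVec_one_sub, matVec_mul, hadd, ← hQx, sub_add_cancel, add_sub_cancel_right]
  have hcross : (inner ℂ (matVec A x) c).re = ‖x‖ ^ 2 - ‖matVec A x‖ ^ 2 := by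
    rw [← Complex.ofReal_re (‖x‖ ^ 2 - _), ← inner_one_sub_conjTranspose_mul_self, hQx,
      inner_matVec_left, ← inner_conj_symm, Complex.conj_re]
  have hle := h x
  rw [norm_add_sq (𝕜 := ℂ), RCLike.re_to_complex, hcross] at hle
  rw [inner_matVec_pseudoInv_of_matVec_eq
      (Matrix.isHermitian_one.sub (Matrix.isHermitian_mul_conjTranspose_self A)) hPy,
    inner_add_left, Complex.add_re, hcross, ← RCLike.re_to_complex, inner_self_eq_norm_sq]
  linarith

end PseudoInverse

section BlockCoordinates

variable {E : Type*} [NormedAddCommGroup E] [InnerProductSpace ℂ E] {p q r : ℕ}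
  (B : OrthonormalBasis (Fin p ⊕ Fin q ⊕ Fin r) ℂ E)

/-- The coordinates of a vector in an orthonormal basis indexed by three blocks. -/
noncomputable def blockCoord : E ≃ₗ[ℂ] CSpace p × CSpace q × CSpace r where
  toFun ω := (WithLp.toLp 2 fun i => B.repr ω (.inl i),
    WithLp.toLp 2 fun i => B.repr ω (.inr (.inl i)),
    WithLp.toLp 2 fun i => B.repr ω (.inr (.inr i)))
  invFun y := B.repr.symm (WithLp.toLp 2 (Sum.elim y.1 (Sum.elim y.2.1 y.2.2)))
  map_add' x y := by ext <;> simp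
  map_smul' a x := by ext <;> simp
  left_inv ω := by
    refine B.repr.injective ?_
    ext (i | i | i) <;> simp
  right_inv y := by ext <;> simp

theorem blockCoord_fst_apply (ω : E) (i : Fin p) :
    (blockCoord B ω).1 i = inner ℂ (B (.inl i)) ω := B.repr_apply_apply ω _

theorem blockCoord_snd_fst_apply (ω : E) (i : Fin q) :
    (blockCoord B ω).2.1 i = inner ℂ (B (.inr (.inl i))) ω := B.repr_apply_apply ω _

theorem blockCoord_snd_snd_apply (ω : E) (i : Fin r) :
    (blockCoord B ω).2.2 i = inner ℂ (B (.inr (.inr i))) ω := B.repr_apply_apply ω _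

theorem norm_sq_blockCoord (ω : E) :
    ‖(blockCoord B ω).1‖ ^ 2 + ‖(blockCoord B ω).2.1‖ ^ 2 + ‖(blockCoord B ω).2.2‖ ^ 2
      = ‖ω‖ ^ 2 := by
  simp only [← B.repr.norm_map ω, EuclideanSpace.norm_sq_eq, Fintype.sum_sum_type, add_assoc]
  rfl

theorem blockCoord_mem_siegel_iff (x : ℂ × E) :
    (x.1, blockCoord B x.2) ∈ siegel p q r ↔ x ∈ siegelDomain E := by
  rw [siegel, siegelDomain, mem_ofPred_eq, norm_sq_blockCoord]
  rfl

theorem norm_eq_of_blockCoord_eq {ω : E} {x : CSpace r} (hω : blockCoord B ω = (0, 0, x)) :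
    ‖ω‖ = ‖x‖ := by
  have hsq := norm_sq_blockCoord B ω
  simp only [hω, norm_zero, ne_eq, OfNat.ofNat_ne_zero, not_false_eq_true, zero_pow,
    zero_add] at hsq
  exact ((pow_left_inj₀ (norm_nonneg _) (norm_nonneg _) two_ne_zero).1 hsq).symm

/-- The third diagonal block of the matrix of `T` in the basis `B`. -/
noncomputable def cornerMatrix (T : E →ₗ[ℂ] E) : Matrix (Fin r) (Fin r) ℂ :=
  .of fun i j => inner ℂ (B (.inr (.inr i))) (T (B (.inr (.inr j))))

variable {B} {T : E →ₗ[ℂ] E} {μ : Fin q → ℂ}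

namespace IsUnimodularSplitting

theorem spectrum_diagonal_subset (h : IsUnimodularSplitting T B μ) :
    spectrum ℂ (Matrix.diagonal μ) ⊆ Metric.sphere 0 1 \ {1} := by
  rw [spectrum_diagonal]
  rintro _ ⟨i, rfl⟩
  exact ⟨mem_sphere_zero_iff_norm.2 (h.norm_eq_one i), h.ne_one i⟩

theorem blockCoord_eq_of_norm_add_sq_le (h : IsUnimodularSplitting T B μ) {c : E} {β : ℝ}
    (hc : ∀ ω, ‖T ω + c‖ ^ 2 ≤ ‖ω‖ ^ 2 + β) : blockCoord B c = (0, 0, (blockCoord B c).2.2) := by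
  ext i
  · have hinner := inner_apply_eq_zero_of_norm_eq hc (congrArg norm (h.apply_inl i))
    rw [h.apply_inl] at hinner
    rw [blockCoord_fst_apply, hinner]
    rfl
  · have hnorm : ‖T (B (.inr (.inl i)))‖ = ‖B (.inr (.inl i))‖ := by
      rw [h.apply_inr_inl, norm_smul, h.norm_eq_one, one_mul]
    have hμ : starRingEnd ℂ (μ i) ≠ 0 := by
      rw [← norm_ne_zero_iff, RCLike.norm_conj, h.norm_eq_one]
      exact one_ne_zero
    have hinner := inner_apply_eq_zero_of_norm_eq hc hnorm
    rw [h.apply_inr_inl, inner_smul_left] at hinner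
    rw [blockCoord_snd_fst_apply, (mul_eq_zero.1 hinner).resolve_left hμ]
    rfl
  · rfl

variable [FiniteDimensional ℂ E]

theorem blockCoord_apply (h : IsUnimodularSplitting T B μ) (hT : ∀ ω, ‖T ω‖ ≤ ‖ω‖) (ω : E) :
    blockCoord B (T ω) = ((blockCoord B ω).1, matVec (.diagonal μ) (blockCoord B ω).2.1,
      matVec (cornerMatrix B T) (blockCoord B ω).2.2) := by
  ext i
  · have hadj := adjoint_apply_of_norm_eq_one hT (μ := 1) norm_one
      (by rw [h.apply_inl i, one_smul])
    rw [blockCoord_fst_apply, blockCoord_fst_apply, ← LinearMap.adjoint_inner_left, hadj,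
      map_one, one_smul]
  · have hadj := adjoint_apply_of_norm_eq_one hT (h.norm_eq_one i) (h.apply_inr_inl i)
    rw [blockCoord_snd_fst_apply, ← LinearMap.adjoint_inner_left, hadj, inner_smul_left,
      Complex.conj_conj, ← blockCoord_snd_fst_apply]
    exact (Matrix.mulVec_diagonal μ _ i).symm
  · have hon := orthonormal_iff_ite.1 B.orthonormal
    have hexpand : inner ℂ (B (.inr (.inr i))) (T ω)
        = ∑ j, inner ℂ (B j) ω * inner ℂ (B (.inr (.inr i))) (T (B j)) := by
      conv_lhs => rw [← B.sum_repr' ω]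
      simp only [map_sum, map_smul, inner_sum, inner_smul_right]
    rw [blockCoord_snd_snd_apply, hexpand]
    simp [Fintype.sum_sum_type, h.apply_inl, h.apply_inr_inl, hon, matVec, Matrix.mulVec,
      dotProduct, cornerMatrix, blockCoord_snd_snd_apply, mul_comm]

theorem blockCoord_apply_of_eq (h : IsUnimodularSplitting T B μ) (hT : ∀ ω, ‖T ω‖ ≤ ‖ω‖) {ω : E}
    {x : CSpace r} (hω : blockCoord B ω = (0, 0, x)) :
    blockCoord B (T ω) = (0, 0, matVec (cornerMatrix B T) x) := by
  rw [h.blockCoord_apply hT, hω]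
  exact congrArg (fun y => (0, y, _)) (map_zero (Matrix.toEuclideanLin (.diagonal μ)))

theorem norm_matVec_cornerMatrix_le (h : IsUnimodularSplitting T B μ) (hT : ∀ ω, ‖T ω‖ ≤ ‖ω‖)
    (x : CSpace r) : ‖matVec (cornerMatrix B T) x‖ ≤ ‖x‖ := by
  obtain ⟨ω, hω⟩ := (blockCoord B).surjective (0, 0, x)
  rw [← norm_eq_of_blockCoord_eq B hω,
    ← norm_eq_of_blockCoord_eq B (h.blockCoord_apply_of_eq hT hω)]
  exact hT ω

theorem norm_matVec_cornerMatrix_add_sq_le (h : IsUnimodularSplitting T B μ)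
    (hT : ∀ ω, ‖T ω‖ ≤ ‖ω‖) {c : E} {β : ℝ} (hc : ∀ ω, ‖T ω + c‖ ^ 2 ≤ ‖ω‖ ^ 2 + β)
    (x : CSpace r) :
    ‖matVec (cornerMatrix B T) x + (blockCoord B c).2.2‖ ^ 2 ≤ ‖x‖ ^ 2 + β := by
  obtain ⟨ω, hω⟩ := (blockCoord B).surjective (0, 0, x)
  have hsum : blockCoord B (T ω + c)
      = (0, 0, matVec (cornerMatrix B T) x + (blockCoord B c).2.2) := by
    rw [map_add, h.blockCoord_apply_of_eq hT hω, h.blockCoord_eq_of_norm_add_sq_le hc,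
      Prod.mk_add_mk, Prod.mk_add_mk, add_zero, add_zero]
  rw [← norm_eq_of_blockCoord_eq B hω, ← norm_eq_of_blockCoord_eq B hsum]
  exact hc ω

theorem norm_lt_one_of_mem_spectrum_cornerMatrix (h : IsUnimodularSplitting T B μ)
    (hT : ∀ ω, ‖T ω‖ ≤ ‖ω‖) {ν : ℂ} (hν : ν ∈ spectrum ℂ (cornerMatrix B T)) : ‖ν‖ < 1 := by
  rw [← Matrix.spectrum_toLpLin 2, ← Module.End.hasEigenvalue_iff_mem_spectrum] at hν
  obtain ⟨x, hx⟩ := hν.exists_hasEigenvector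
  have hxν : matVec (cornerMatrix B T) x = ν • x := hx.apply_eq_smul
  obtain ⟨ω, hω⟩ := (blockCoord B).surjective (0, 0, x)
  have hω0 : ω ≠ 0 := by
    rw [← norm_ne_zero_iff, norm_eq_of_blockCoord_eq B hω]
    exact norm_ne_zero_iff.2 hx.2
  have hTω : T ω = ν • ω := (blockCoord B).injective <| by
    rw [h.blockCoord_apply_of_eq hT hω, map_smul, hω, hxν, Prod.smul_mk, Prod.smul_mk,
      smul_zero, smul_zero]
  refine h.norm_lt_one hω0 hTω (fun i => ?_) fun i => ?_
  · rw [← blockCoord_fst_apply, hω]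
    rfl
  · rw [← blockCoord_snd_fst_apply, hω]
    rfl

end IsUnimodularSplitting

variable [FiniteDimensional ℂ E]

theorem IsUnimodularSplitting.areConjugate_hyperbolicForm (h : IsUnimodularSplitting T B μ)
    (hT : ∀ ω, ‖T ω‖ ≤ ‖ω‖) {c : E} {β : ℝ} (hc : ∀ ω, ‖T ω + c‖ ^ 2 ≤ ‖ω‖ ^ 2 + β)
    (ℓ : ℝ) (b : ℂ) :
    AreConjugate (siegelAffine ℓ b 0 ((√ℓ : ℂ) • T) c) (siegelDomain E)
      (hyperbolicForm ℓ b (.diagonal μ) (cornerMatrix B T) (blockCoord B c).2.2)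
      (siegel p q r) := by
  refine .of_linearEquiv ((LinearEquiv.refl ℂ ℂ).prodCongr (blockCoord B))
    (blockCoord_mem_siegel_iff B) fun x _ => ?_
  have hx : blockCoord B ((√ℓ : ℂ) • T x.2 + c) = ((√ℓ : ℂ) • (blockCoord B x.2).1,
      (√ℓ : ℂ) • matVec (.diagonal μ) (blockCoord B x.2).2.1,
      (√ℓ : ℂ) • matVec (cornerMatrix B T) (blockCoord B x.2).2.2 + (blockCoord B c).2.2) := by
    rw [map_add, map_smul, h.blockCoord_apply hT, h.blockCoord_eq_of_norm_add_sq_le hc]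
    simp only [Prod.smul_mk, Prod.mk_add_mk, add_zero]
  ext1
  · change (ℓ : ℂ) * x.1 + 0 + b = ℓ * x.1 + b
    rw [add_zero]
  · exact hx

theorem exists_areConjugate_hyperbolicForm {ℓ : ℝ} (hℓ : 0 < ℓ) {b : ℂ} {M : E →ₗ[ℂ] E} {c : E}
    (h : MapsTo (siegelAffine ℓ b 0 M c) (siegelDomain E) (siegelDomain E)) :
    ∃ (p q r : ℕ) (D : Matrix (Fin q) (Fin q) ℂ) (A : Matrix (Fin r) (Fin r) ℂ) (c' : CSpace r),
      p + q + r = Module.finrank ℂ E ∧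
      AreConjugate (siegelAffine ℓ b 0 M c) (siegelDomain E)
        (hyperbolicForm ℓ b D A c') (siegel p q r) ∧
      D.IsDiag ∧ spectrum ℂ D ⊆ Metric.sphere 0 1 \ {1} ∧ (∀ μ ∈ spectrum ℂ A, ‖μ‖ < 1) ∧
      (∀ x, ‖matVec A x‖ ≤ ‖x‖) ∧ ∀ x, ‖matVec A x + c'‖ ^ 2 ≤ ‖x‖ ^ 2 + b.im := by
  have hsqrt : (√ℓ : ℂ) ≠ 0 := by exact_mod_cast (Real.sqrt_pos.2 hℓ).ne'
  obtain ⟨T, rfl⟩ : ∃ T : E →ₗ[ℂ] E, M = (√ℓ : ℂ) • T :=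
    ⟨(√ℓ : ℂ)⁻¹ • M, (smul_inv_smul₀ hsqrt M).symm⟩
  have hT : ∀ ω, ‖T ω‖ ≤ ‖ω‖ := fun ω => by
    have hle := norm_le_sqrt_mul_of_mapsTo_siegelAffine h ω
    rw [LinearMap.smul_apply, norm_smul, Complex.norm_of_nonneg (Real.sqrt_nonneg ℓ)] at hle
    exact le_of_mul_le_mul_left hle (Real.sqrt_pos.2 hℓ)
  have hc : ∀ ω, ‖T ω + c‖ ^ 2 ≤ ‖ω‖ ^ 2 + b.im := fun ω => by
    have hle := norm_add_sq_le_of_mapsTo_siegelAffine h ((√ℓ : ℂ)⁻¹ • ω)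
    rw [LinearMap.smul_apply, map_smul, smul_inv_smul₀ hsqrt, norm_smul, norm_inv,
      Complex.norm_of_nonneg (Real.sqrt_nonneg ℓ), mul_pow, inv_pow, Real.sq_sqrt hℓ.le,
      mul_inv_cancel_left₀ hℓ.ne', LinearMap.zero_apply, Complex.zero_im, add_zero] at hle
    exact hle
  obtain ⟨p, q, r, B, μ, hB⟩ := exists_isUnimodularSplitting hT
  refine ⟨p, q, r, _, _, _, ?_, hB.areConjugate_hyperbolicForm hT hc ℓ b,
    Matrix.isDiag_diagonal μ, hB.spectrum_diagonal_subset,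
    fun ν => hB.norm_lt_one_of_mem_spectrum_cornerMatrix hT, hB.norm_matVec_cornerMatrix_le hT,
    hB.norm_matVec_cornerMatrix_add_sq_le hT hc⟩
  simp [Module.finrank_eq_card_basis B.toBasis, add_assoc]

end BlockCoordinates

theorem IsLFTBall.exists_areConjugate_siegelAffine {N : ℕ} {φ : CSpace N → CSpace N} {w : CSpace N}
    {δ : ℝ} (h : IsLFTBall φ) (hfix : ∀ z ∈ unitBall N, φ z ≠ z) (hw : IsDenjoyWolffPoint φ w)
    (hlim : liminf (fun z => (((1 - ‖φ z‖ ^ 2) / (1 - ‖z‖ ^ 2) : ℝ) : EReal)) (𝓝[unitBall N] w)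
      = δ) :
    ∃ (b : ℂ) (a : (ℂ ∙ w)ᗮ →ₗ[ℂ] ℂ) (M : (ℂ ∙ w)ᗮ →ₗ[ℂ] (ℂ ∙ w)ᗮ) (c : (ℂ ∙ w)ᗮ),
      AreConjugate φ (unitBall N) (siegelAffine (δ⁻¹ : ℝ) b a M c) (siegelDomain (ℂ ∙ w)ᗮ) := by
  obtain ⟨hmap, L, B, C, D, hL⟩ := h
  have hφ : IsLinearFractionalSelfMap φ (Matrix.toEuclideanLin L) B C D :=
    ⟨hmap, fun z hz => (hL z hz).1, fun z hz => (hL z hz).2⟩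
  have horbit : Tendsto (fun n => φ^[n] 0) atTop (𝓝 w) :=
    (hw.2 {0} (by simp [unitBall]) isCompact_singleton).tendsto_at (mem_singleton 0)
  have hden := hφ.den_ne_zero_of_norm_eq_one hfix hw.1
  have hnum := hφ.num_eq_of_tendsto_iterate (LinearMap.continuous_of_finiteDimensional _)
    (Metric.mem_ball_self one_pos) horbit hden
  obtain ⟨ℓ, b, a, M, c, hℓ, hconj, hslope⟩ := hφ.exists_siegelAffine hw.1 hnum hden
  have hδ : δ = ℓ⁻¹ := EReal.coe_injective <| hlim.symm.trans <|
    liminf_one_sub_norm_sq_div_eq hw.1 hℓ hmap hconj hslope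
  rw [hδ, inv_inv]
  exact ⟨b, a, M, c, areConjugate_siegelAffine hw.1 hconj⟩

theorem mainTheorem10 (N : ℕ) (φ : CSpace N → CSpace N) (hφ : IsLFTBall φ)
    (hyp : IsHyperbolicMap φ) :
    ∃ (p q r : ℕ) (ℓ : ℝ) (b : ℂ) (D : Matrix (Fin q) (Fin q) ℂ)
      (A : Matrix (Fin r) (Fin r) ℂ) (c : CSpace r),
      1 + p + q + r = N ∧
      1 < ℓ ∧ HasBoundaryDilation φ ℓ⁻¹ ∧
      MapsTo (hyperbolicForm ℓ b D A c) (siegel p q r) (siegel p q r) ∧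
      AreConjugate φ (unitBall N) (hyperbolicForm ℓ b D A c) (siegel p q r) ∧
      D.IsDiag ∧ spectrum ℂ D ⊆ Metric.sphere 0 1 \ {1} ∧
      (∀ μ ∈ spectrum ℂ A, ‖μ‖ < 1) ∧
      (1 - Aᴴ * A).PosSemidef ∧ (1 - A * Aᴴ).PosSemidef ∧
      (inner ℂ c (matVec (pseudoInv (1 - A * Aᴴ)) c)).re ≤ b.im ∧
      matVec ((1 - Aᴴ * A) * pseudoInv (1 - Aᴴ * A) * Aᴴ) c = matVec Aᴴ c := by
  obtain ⟨hfix, δ, ⟨hδ0, hδ1⟩, w, hw, hlim⟩ := hyp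
  have hℓ : 1 < δ⁻¹ := (one_lt_inv₀ hδ0).2 hδ1
  obtain ⟨b₀, a, M, c₀, hCayley⟩ := hφ.exists_areConjugate_siegelAffine hfix hw hlim
  obtain ⟨b, c₁, hHeisenberg⟩ := exists_areConjugate_siegelAffine_zero hℓ (hCayley.mapsTo hφ.1)
  have haffine := hCayley.trans hHeisenberg
  obtain ⟨p, q, r, D, A, c, hdim, hblock, hDiag, hD, hAspec, hA, hAc⟩ :=
    exists_areConjugate_hyperbolicForm (zero_lt_one.trans hℓ) (haffine.mapsTo hφ.1)
  have hconj := haffine.trans hblock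
  have hN : 1 + p + q + r = N := by
    have hsum := (ℂ ∙ w).finrank_add_finrank_orthogonal
    rw [finrank_span_singleton (norm_ne_zero_iff.1 (hw.1 ▸ one_ne_zero)),
      finrank_euclideanSpace_fin] at hsum
    omega
  exact ⟨p, q, r, δ⁻¹, b, D, A, c, hN, hℓ, ⟨w, hw, by rwa [inv_inv]⟩, hconj.mapsTo hφ.1, hconj,
    hDiag, hD, hAspec, posSemidef_one_sub_conjTranspose_mul_self hA,
    by simpa using posSemidef_one_sub_conjTranspose_mul_self (norm_matVec_conjTranspose_le hA),
    inner_pseudoInv_one_sub_le_of_norm_add_sq_le hAc,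
    matVec_one_sub_mul_pseudoInv_of_norm_add_sq_le hAc⟩
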